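/- Let $k$ be a field of characteristic $0$ and let functions of the times $(t,\bar t)=(t_1\equiv x,t_2,\dots;\bar t_1,\bar t_2,\dots)$ be formal power series over $k$; write $\partial=\partial/\partial t_1$, $\bar\partial=\partial/\partial\bar t_1$, and $D$, $\bar D$ for the corresponding symbols of pseudo-differential operators. For $(y)=(y_1,y_2,\dots)$ put $[y]=(y_1,y_2/2,y_3/3,\dots)$, and let $p_n$ be the Schur polynomials, $\exp(\sum_{i\ge1}y_iz^i)=\sum_n p_n(y)z^n$. An invertible $\tau$ is a *tau-function* of a KP Lax operator $L=D+\sum_{i\ge1}u_iD^{-i}$, $\partial L/\partial t_l=[(L^l)_+,L]$, if $W=\sum_{n\ge0}\frac{p_n(-[\partial])\tau}{\tau}D^{-n}$ (with $[\partial]=(\partial_{t_1},\tfrac12\partial_{t_2},\tfrac13\partial_{t_3},\dots)$) satisfies $L=WDW^{-1}$, $\partial W/\partial t_l=-(L^l)_-W$, and $\partial\,\partial_{t_l}\ln\tau=\mathrm{Res}\,L^l$ for all $l\ge1$. The same definition is used with $(\bar\partial,\bar D,\bar t)$ in place of $(\partial,D,t)$. Let $L$ be a KP Lax operator with tau-function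 $\tau$ (with respect to $t$). Let $\Phi_j$, $\Psi_j$ ($j\ge1$) be eigenfunctions, $\partial_{t_l}\Phi_j=(L^l)_+(\Phi_j)$, and adjoint eigenfunctions, $\partial_{t_l}\Psi_j=-((L^*)^l)_+(\Psi_j)$, whose Wronskians with respect to $\partial$ satisfy $W_n[\Phi_1,\dots,\Phi_n]\ne0$ and $\mathcal W_n=W_n[\Psi_1,\dots,\Psi_n]$ invertible for all $n$, with $\Phi_1$ invertible. Let $\partial^{-1}(\Phi_i\Psi_j)=S(\Phi_i,\Psi_j)$ be squared eigenfunction potentials, i.e. $\partial_{t_l}S(\Phi_i,\Psi_j)=\mathrm{Res}\big(D^{-1}\Psi_j(L^l)_+\Phi_iD^{-1}\big)$ for $l\ge 1$. Assume that, for all $s\ge1$, the $\bar t_s$-dependence is given by the ghost flows $$\partial_{\bar t_s}L=[\mathcal M_s,L],\quad \partial_{\bar t_s}W=\mathcal M_sW,\quad \mathcal M_s=\sum_{j=1}^s\Phi_{s-j+1}D^{-1}\Psi_j,$$ $$\partial_{\bar t_s}\Phi_i=\sum_{j=1}^s\Phi_{s-j+1}\partial^{-1}(\Psi_j\Phi_i)-\Phi_{i+s},\qquad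 \partial_{\bar t_s}\Psi_i=\sum_{j=1}^s\Psi_j\partial^{-1}(\Phi_{s-j+1}\Psi_i)+\Psi_{i+s}.$$ Put $\mathcal W_0=1$ and $\mathcal W_{j-1}(\Psi_i)=W_j[\Psi_1,\dots,\Psi_{j-1},\Psi_i]$, and $$\bar M_s=\sum_{j=1}^s\Big(\sum_{i=j}^s\frac{\Phi_{s-i+1}}{\Phi_1}\frac{\mathcal W_{j-1}(\Psi_i)}{\mathcal W_j}\Big)\Big(\bar D-\bar\partial\ln\tfrac{\mathcal W_{j-1}}{\mathcal W_{j-2}}\Big)\cdots\Big(\bar D-\bar\partial\ln\Psi_1\Big)\Big(\bar D-\bar\partial\ln\tfrac1{\Phi_1}\Big)-\partial_{\bar t_s}\ln\Phi_1 ,$$ where the product has $j$ factors. Then there is exactly one KP Lax operator $\bar{\mathcal L}=\bar D+\sum_{i\ge1}\bar u_i\bar D^{-i}$, $\partial_{\bar t_s}\bar{\mathcal L}=[(\bar{\mathcal L}^s)_+,\bar{\mathcal L}]$, such that $(\bar{\mathcal L}^s)_+=\bar M_s$ for all $s\ge1$ (the ghost Lax operator). Moreover, $\tau$ can be multiplied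 by an invertible function $c$ independent of all $t_l$ (so that it remains a tau-function of $L$) such that, writing $\tau$ again for the product, $$\partial_{\bar t_s}\ln\tau=-\sum_{j=1}^s\partial^{-1}(\Phi_{s-j+1}\Psi_j)\quad(s\ge1),$$ and, with this $\tau$, the function $\bar\tau=\Phi_1\tau$ is a tau-function of $\bar{\mathcal L}$ (with respect to $\bar t$) and $$\frac{p_s(-[\bar\partial])\bar\tau}{\bar\tau}=\frac{\Phi_{s+1}}{\Phi_1}\qquad\text{for all } s\ge0,$$ where $[\bar\partial]=(\partial_{\bar t_1},\tfrac12\partial_{\bar t_2},\tfrac13\partial_{\bar t_3},\dots)$. -/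

import Mathlib

open scoped Nat

noncomputable section

/-! ### Pseudo-differential operators over a differential algebra -/

/-- A formal pseudo-differential operator `∑_{n ≤ N} a_n D^n` with coefficients in `A`; the
symbol `D` stands for the derivation `δ` of `A`. -/
@[ext]
structure PDO {k A : Type*} [Field k] [CommRing A] [Algebra k A] (δ : Derivation k A A) where
  coeff : ℤ → A
  bdd : ∃ N : ℤ, ∀ n, N < n → coeff n = 0

namespace PDO

variable {k A : Type*} [Field k] [CommRing A] [Algebra k A] {δ : Derivation k A A}

instance : Zero (PDO δ) := ⟨⟨fun _ => 0, 0, fun _ _ => rfl⟩⟩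

instance : Add (PDO δ) := ⟨fun P Q => ⟨fun n => P.coeff n + Q.coeff n, by
  obtain ⟨N, hN⟩ := P.bdd
  obtain ⟨M, hM⟩ := Q.bdd
  refine ⟨max N M, fun n hn => ?_⟩
  rw [hN n (lt_of_le_of_lt (le_max_left _ _) hn), hM n (lt_of_le_of_lt (le_max_right _ _) hn),
    add_zero]⟩⟩

instance : Neg (PDO δ) := ⟨fun P => ⟨fun n => -P.coeff n, by
  obtain ⟨N, hN⟩ := P.bdd
  exact ⟨N, fun n hn => by rw [hN n hn, neg_zero]⟩⟩⟩

instance : Sub (PDO δ) := ⟨fun P Q => ⟨fun n => P.coeff n - Q.coeff n, by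
  obtain ⟨N, hN⟩ := P.bdd
  obtain ⟨M, hM⟩ := Q.bdd
  refine ⟨max N M, fun n hn => ?_⟩
  rw [hN n (lt_of_le_of_lt (le_max_left _ _) hn), hM n (lt_of_le_of_lt (le_max_right _ _) hn),
    sub_zero]⟩⟩

instance : AddCommGroup (PDO δ) where
  add_assoc P Q R := PDO.ext (funext fun _ => add_assoc _ _ _)
  zero_add P := PDO.ext (funext fun _ => zero_add _)
  add_zero P := PDO.ext (funext fun _ => add_zero _)
  add_comm P Q := PDO.ext (funext fun _ => add_comm _ _)
  neg_add_cancel P := PDO.ext (funext fun _ => neg_add_cancel _)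
  sub_eq_add_neg P Q := PDO.ext (funext fun _ => sub_eq_add_neg _ _)
  nsmul := nsmulRec
  zsmul := zsmulRec

/-- The operator product, given by the generalized Leibniz rule
`(a D^i) (b D^j) = ∑_{r ≥ 0} binom(i, r) a δ^r(b) D^(i + j - r)`, for all integers `i`, `j`.
The sum below collects the terms with `i + j - r = n`; only finitely many are non-zero. -/
instance : Mul (PDO δ) := ⟨fun P Q => ⟨fun n =>
    ∑ᶠ p : ℤ × ℕ, Ring.choose p.1 p.2 • (P.coeff p.1 * δ^[p.2] (Q.coeff (n - p.1 + p.2))), by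
  obtain ⟨N, hN⟩ := P.bdd
  obtain ⟨M, hM⟩ := Q.bdd
  refine ⟨N + M, fun n hn => finsum_eq_zero_of_forall_eq_zero fun p => ?_⟩
  rcases lt_or_ge N p.1 with h | h
  · rw [hN _ h, zero_mul, smul_zero]
  · rw [hM _ (by omega), iterate_map_zero, mul_zero, smul_zero]⟩⟩

/-- The zero-order operator of multiplication by `a`, times `D^m`. -/
def monomial (δ : Derivation k A A) (m : ℤ) (a : A) : PDO δ :=
  ⟨fun n => if n = m then a else 0, m, fun _ hn => if_neg (ne_of_gt hn)⟩

instance : One (PDO δ) := ⟨monomial δ 0 1⟩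

/-- The zero-order operator of multiplication by `a`. -/
def C (δ : Derivation k A A) (a : A) : PDO δ := monomial δ 0 a

/-- The operator `D^m`, for any integer `m`. -/
def D (δ : Derivation k A A) (m : ℤ) : PDO δ := monomial δ m 1

/-- Powers `P^n` of an operator. -/
def pow (P : PDO δ) : ℕ → PDO δ
  | 0 => 1
  | n + 1 => pow P n * P

/-- The purely differential part `P_+ = ∑_{n ≥ 0} a_n D^n`. -/
def plus (P : PDO δ) : PDO δ := ⟨fun n => if 0 ≤ n then P.coeff n else 0, by
  obtain ⟨N, hN⟩ := P.bdd
  exact ⟨N, fun n hn => by rw [hN n hn, ite_self]⟩⟩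

/-- The purely pseudo-differential part `P_- = ∑_{n ≥ 1} a_{-n} D^{-n}`. -/
def minus (P : PDO δ) : PDO δ := ⟨fun n => if 0 ≤ n then 0 else P.coeff n, by
  obtain ⟨N, hN⟩ := P.bdd
  exact ⟨N, fun n hn => by rw [hN n hn, ite_self]⟩⟩

/-- The residue, i.e. the coefficient of `D^{-1}`. -/
def res (P : PDO δ) : A := P.coeff (-1)

/-- The formal adjoint `(∑ a_n D^n)^* = ∑ (-D)^n a_n`, expanded by the Leibniz rule. -/
def adjoint (P : PDO δ) : PDO δ := ⟨fun m => ∑ᶠ r : ℕ,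
    (((m + r).negOnePow : ℤ) * Ring.choose (m + r) r) • δ^[r] (P.coeff (m + r)), by
  obtain ⟨N, hN⟩ := P.bdd
  refine ⟨N, fun m hm => finsum_eq_zero_of_forall_eq_zero fun r => ?_⟩
  rw [hN _ (by omega), iterate_map_zero, smul_zero]⟩

/-- The action `P_+(f) = ∑_{n ≥ 0} a_n δ^n(f)` of the differential part of `P` on `f`. -/
def applyPlus (P : PDO δ) (f : A) : A := ∑ᶠ n : ℕ, P.coeff n * δ^[n] f

/-- A derivation `d` (for instance along a time) applied to the coefficients of an operator. -/
def deriv (d : Derivation k A A) (P : PDO δ) : PDO δ := ⟨fun n => d (P.coeff n), by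
  obtain ⟨N, hN⟩ := P.bdd
  exact ⟨N, fun n hn => by rw [hN n hn, map_zero]⟩⟩

end PDO

/-! ### Functions of the two sets of times -/

/-- Functions of `(t, t̄) = (t_1, t_2, …; t̄_1, t̄_2, …)`: formal power series, where the variable
`Sum.inl i` is `t_{i+1}` and the variable `Sum.inr i` is `t̄_{i+1}`. -/
abbrev TimeFun (k : Type*) [Field k] := MvPowerSeries (ℕ ⊕ ℕ) k

/-- `∂/∂t_l` for `l ≥ 1`; `x = t_1`, so that `∂ = dt k 1`. -/
def dt (k : Type*) [Field k] (l : ℕ) : Derivation k (TimeFun k) (TimeFun k) :=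
  MvPowerSeries.pderiv k (Sum.inl (l - 1))

/-- `∂/∂t̄_s` for `s ≥ 1`; `∂̄ = dtb k 1`. -/
def dtb (k : Type*) [Field k] (s : ℕ) : Derivation k (TimeFun k) (TimeFun k) :=
  MvPowerSeries.pderiv k (Sum.inr (s - 1))

/-- The Schur polynomial `p_n(y_1, y_2, …)`, i.e. the coefficient of `z^n` in
`exp (∑_{i ≥ 1} y_i z^i)`, at elements `y_i` of a `k`-algebra. (The terms of the exponential
series of degree greater than `n` do not contribute.) -/
def schur (k : Type*) {R : Type*} [Field k] [Ring R] [Algebra k R] (y : ℕ → R) (n : ℕ) : R :=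
  ∑ m ∈ Finset.range (n + 1), ((m ! : k)⁻¹) •
    PowerSeries.coeff n ((PowerSeries.mk fun i => if i = 0 then 0 else y i) ^ m)

/-- The differential operator `p_n(-[∂])`, `[∂] = (∂_1, ∂_2 / 2, ∂_3 / 3, …)`, for a family
`∂_1, ∂_2, …` of derivations. -/
def schurOp {k : Type*} [Field k] (d : ℕ → Derivation k (TimeFun k) (TimeFun k)) (n : ℕ) :
    Module.End k (TimeFun k) :=
  schur k (fun i => -((i : k)⁻¹ • (d i : TimeFun k →ₗ[k] TimeFun k))) n

/-- The logarithmic derivative `d ln f`. -/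
def dlog {k : Type*} [Field k] (d : Derivation k (TimeFun k) (TimeFun k)) (f : TimeFun k) :
    TimeFun k := d f * f⁻¹

/-! ### The KP hierarchy

Here `d 1, d 2, …` are the derivations along the times of the hierarchy, and `d 1` is the
derivation represented by the symbol `D`. -/

/-- `L = D + ∑_{i ≥ 1} u_i D^{-i}` and `∂L/∂t_l = [(L^l)_+, L]` for all `l ≥ 1`. -/
structure IsKPLax {k : Type*} [Field k] (d : ℕ → Derivation k (TimeFun k) (TimeFun k))
    (L : PDO (d 1)) : Prop where
  coeff_gt_one : ∀ n, 1 < n → L.coeff n = 0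
  coeff_one : L.coeff 1 = 1
  coeff_zero : L.coeff 0 = 0
  lax : ∀ l, 1 ≤ l → PDO.deriv (d l) L = (L.pow l).plus * L - L * (L.pow l).plus

/-- The operator `W = ∑_{n ≥ 0} (p_n(-[∂]) τ / τ) D^{-n}`. -/
def dressing {k : Type*} [Field k] (d : ℕ → Derivation k (TimeFun k) (TimeFun k))
    (τ : TimeFun k) : PDO (d 1) :=
  ⟨fun n => if 0 < n then 0 else schurOp d (-n).toNat τ * τ⁻¹, 0, fun _ hn => if_pos hn⟩

/-- `τ` is a tau-function of `L`: the operator `W` built from `τ` is a dressing operator,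
`L = W D W⁻¹` (written as `L W = W D`; `W` is invertible, having leading term `1`) and
`∂W/∂t_l = -(L^l)_- W`; moreover `∂_x ∂/∂t_l ln τ = Res L^l`. -/
structure IsTauFunction {k : Type*} [Field k] (d : ℕ → Derivation k (TimeFun k) (TimeFun k))
    (L : PDO (d 1)) (τ : TimeFun k) : Prop where
  isUnit : IsUnit τ
  dress : L * dressing d τ = dressing d τ * PDO.D (d 1) 1
  sato : ∀ l, 1 ≤ l → PDO.deriv (d l) (dressing d τ) = -((L.pow l).minus * dressing d τ)
  res : ∀ l, 1 ≤ l → d 1 (dlog (d l) τ) = (L.pow l).res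

/-- Eigenfunctions: `∂Φ/∂t_l = (L^l)_+(Φ)`. -/
def IsEigenfunction {k : Type*} [Field k] (d : ℕ → Derivation k (TimeFun k) (TimeFun k))
    (L : PDO (d 1)) (Φ : TimeFun k) : Prop :=
  ∀ l, 1 ≤ l → d l Φ = (L.pow l).applyPlus Φ

/-- Adjoint eigenfunctions: `∂Ψ/∂t_l = -((L^*)^l)_+(Ψ)`. -/
def IsAdjointEigenfunction {k : Type*} [Field k]
    (d : ℕ → Derivation k (TimeFun k) (TimeFun k)) (L : PDO (d 1)) (Ψ : TimeFun k) : Prop :=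
  ∀ l, 1 ≤ l → d l Ψ = -(L.adjoint.pow l).applyPlus Ψ

/-- `S` is a squared eigenfunction potential `∂⁻¹(Φ Ψ)` of the eigenfunction `Φ` and the adjoint
eigenfunction `Ψ`: `∂S/∂t_l = Res (D⁻¹ Ψ (L^l)_+ Φ D⁻¹)`. For `l = 1` this is `∂_x S = Φ Ψ`. -/
def IsSEP {k : Type*} [Field k] (d : ℕ → Derivation k (TimeFun k) (TimeFun k))
    (L : PDO (d 1)) (Φ Ψ S : TimeFun k) : Prop :=
  ∀ l, 1 ≤ l → d l S = (PDO.D (d 1) (-1) * (PDO.C (d 1) Ψ *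
    ((L.pow l).plus * (PDO.C (d 1) Φ * PDO.D (d 1) (-1))))).res

/-- The Wronskian `W_n[f_1, …, f_n] = det (∂^(α-1) f_β)`. -/
def wronsk {k : Type*} [Field k] {n : ℕ} (f : Fin n → TimeFun k) : TimeFun k :=
  Matrix.det (Matrix.of fun α β : Fin n => (dt k 1)^[(α : ℕ)] (f β))

/-- `W_n[f_1, …, f_n]` for a sequence `f_1, f_2, …` -/
def seqWronsk {k : Type*} [Field k] (f : ℕ → TimeFun k) (n : ℕ) : TimeFun k :=
  wronsk fun i : Fin n => f (i + 1)

/-- `W_n(g) = W_{n+1}[f_1, …, f_n, g]`. -/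
def seqWronskAppend {k : Type*} [Field k] (f : ℕ → TimeFun k) (n : ℕ) (g : TimeFun k) :
    TimeFun k :=
  wronsk (Fin.snoc (α := fun _ => TimeFun k) (fun i : Fin n => f (i + 1)) g)

/-! ### Ghost flows

Sequences `Φ_1, Φ_2, …`, `Ψ_1, Ψ_2, …` and `S i j = ∂⁻¹(Φ_i Ψ_j)` are indexed from `1`; the
values at the index `0` are never used. -/

/-- `M_s = ∑_{j=1}^s Φ_{s-j+1} D⁻¹ Ψ_j`. -/
def ghostM {k : Type*} [Field k] (Φ Ψ : ℕ → TimeFun k) (s : ℕ) : PDO (dt k 1) :=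
  ∑ j ∈ Finset.Icc 1 s,
    PDO.C (dt k 1) (Φ (s - j + 1)) * (PDO.D (dt k 1) (-1) * PDO.C (dt k 1) (Ψ j))

/-- The KP hierarchy `L` with tau-function `τ` (as a function of `t`), together with the ghost
symmetry flows `∂/∂t̄_s` generated by independent (adjoint) eigenfunctions `Φ_j`, `Ψ_j`;
`S i j` is the squared eigenfunction potential `∂⁻¹(Φ_i Ψ_j)` which enters the flows. -/
structure IsGhostSystem {k : Type*} [Field k] (L : PDO (dt k 1)) (τ : TimeFun k)
    (Φ Ψ : ℕ → TimeFun k) (S : ℕ → ℕ → TimeFun k) : Prop where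
  lax : IsKPLax (dt k) L
  tau : IsTauFunction (dt k) L τ
  eigen : ∀ j, 1 ≤ j → IsEigenfunction (dt k) L (Φ j)
  adjEigen : ∀ j, 1 ≤ j → IsAdjointEigenfunction (dt k) L (Ψ j)
  sep : ∀ i j, 1 ≤ i → 1 ≤ j → IsSEP (dt k) L (Φ i) (Ψ j) (S i j)
  isUnit_Φ : IsUnit (Φ 1)
  wronsk_Φ : ∀ n, seqWronsk Φ n ≠ 0
  wronsk_Ψ : ∀ n, IsUnit (seqWronsk Ψ n)
  flow_L : ∀ s, 1 ≤ s → PDO.deriv (dtb k s) L = ghostM Φ Ψ s * L - L * ghostM Φ Ψ s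
  flow_W : ∀ s, 1 ≤ s →
    PDO.deriv (dtb k s) (dressing (dt k) τ) = ghostM Φ Ψ s * dressing (dt k) τ
  flow_Φ : ∀ s i, 1 ≤ s → 1 ≤ i →
    dtb k s (Φ i) = ∑ j ∈ Finset.Icc 1 s, Φ (s - j + 1) * S i j - Φ (i + s)
  flow_Ψ : ∀ s i, 1 ≤ s → 1 ≤ i →
    dtb k s (Ψ i) = ∑ j ∈ Finset.Icc 1 s, Ψ j * S (s - j + 1) i + Ψ (i + s)

/-- The products `(D̄ - ∂̄ ln (𝒲_{j-1}/𝒲_{j-2})) ⋯ (D̄ - ∂̄ ln Ψ_1) (D̄ - ∂̄ ln (1/Φ_1))` of `j`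
factors, where `𝒲_n = W_n[Ψ_1, …, Ψ_n]`. -/
def ghostFactors {k : Type*} [Field k] (Φ Ψ : ℕ → TimeFun k) : ℕ → PDO (dtb k 1)
  | 0 => 1
  | 1 => PDO.D (dtb k 1) 1 - PDO.C (dtb k 1) (dlog (dtb k 1) (Φ 1)⁻¹)
  | j + 2 => (PDO.D (dtb k 1) 1 - PDO.C (dtb k 1)
      (dlog (dtb k 1) (seqWronsk Ψ (j + 1) * (seqWronsk Ψ j)⁻¹))) * ghostFactors Φ Ψ (j + 1)

/-- The `∂̄`-differential operators
`M̄_s = ∑_{j=1}^s (∑_{i=j}^s (Φ_{s-i+1}/Φ_1) 𝒲_{j-1}(Ψ_i)/𝒲_j)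
  (D̄ - ∂̄ ln (𝒲_{j-1}/𝒲_{j-2})) ⋯ (D̄ - ∂̄ ln (1/Φ_1)) - ∂/∂t̄_s ln Φ_1`
which describe the ghost flows of `F/Φ_1` for eigenfunctions `F`. -/
def ghostMbar {k : Type*} [Field k] (Φ Ψ : ℕ → TimeFun k) (s : ℕ) : PDO (dtb k 1) :=
  ∑ j ∈ Finset.Icc 1 s,
    PDO.C (dtb k 1) (∑ i ∈ Finset.Icc j s,
      Φ (s - i + 1) * (Φ 1)⁻¹ * (seqWronskAppend Ψ (j - 1) (Ψ i) * (seqWronsk Ψ j)⁻¹)) *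
      ghostFactors Φ Ψ j
  - PDO.C (dtb k 1) (dlog (dtb k s) (Φ 1))

/-- `L̄` is the ghost Lax operator: a `∂̄`-pseudo-differential KP Lax operator with respect to the
times `t̄` such that `(L̄^s)_+ = M̄_s` for all `s ≥ 1`. -/
def IsGhostLax {k : Type*} [Field k] (Φ Ψ : ℕ → TimeFun k) (Lb : PDO (dtb k 1)) : Prop :=
  IsKPLax (dtb k) Lb ∧ ∀ s, 1 ≤ s → (Lb.pow s).plus = ghostMbar Φ Ψ s

end

/-! The ghost hierarchy has an explicit dressing operator, `W̄ = Φ_1⁻¹ F` with `F = ∑ Φ_{n+1}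
D̄^{-n}`. In the ghost flow of `Φ_i` the term `-Φ_{i+s}` is the shift produced by multiplying `F` by
`D̄^s` on the right. Hence `∂F/∂t̄_s + F D̄^s = ∑_j Φ_{s-j+1} P_j` with `P_j = D̄^j + ∑_i S(Φ_i,
Ψ_j) D̄^{1-i}` (`flow_ghostSeries`). The first ghost flow of the potentials says `D̄ P_j = P_{j+1} +
S(Φ_1, Ψ_j) P_1` (`D_mul_ghostPotential`), and `s = 1` gives `P_1 = (D̄ - ∂̄ ln(1/Φ_1)) W̄`. So
every `P_j` is a differential operator times `W̄`, with Wronskian quotients as coefficients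
(`ghostPotential_eq_sum`), and `∂W̄/∂t̄_s + W̄ D̄^s = M̄_s W̄` (`flow_ghostDressing`). Since `M̄_s`
is differential, `L̄ = W̄ D̄ W̄⁻¹` has `(L̄^s)_+ = M̄_s` and satisfies the Lax equations. It is
unique because the `D̄^0` coefficient of `L̄^n` determines `ū_{n-1}` in terms of the earlier
coefficients, as `n` is invertible.

The ghost flow of the potentials is itself derived (`dtb_S`). The expected formula holds up to an
error annihilated by `∂`; commuting two ghost flows on `Φ_i` gives a linear relation among the `Φ_a`
with such errors as coefficients, and non-vanishing Wronskians kill them.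

For the tau-function, the coefficients of the dressing operator of `τ` obey a recursion involving
`∂_{t_l} ln τ`. The ghost derivatives of these coefficients obey a companion recursion involving
`∂_{t_l} S` (`squared_eigenfunction_recursion`). Comparing the two shows that `∂_{t̄_s} ln τ + ∑ S`
is independent of `t` (`deriv_dlog_of_flow`). By the flow of the potentials it is also closed in
`t̄`, so it can be integrated and absorbed into a factor `c`. With `τ` so normalized, `n p_n = -∑_l
∂_{t̄_l} p_{n-l}` and induction give `p_n(-[∂̄])(Φ_1 τ) = Φ_{n+1} τ`, because the terms containing
potentials cancel by symmetry. Thus `W̄` is the dressing operator built from `Φ_1 τ`. -/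

open Finset.HasAntidiagonal (antidiagonal mem_antidiagonal)

/-! ### The ring of pseudo-differential operators -/

namespace PDO

variable {k A : Type*} [Field k] [CommRing A] [Algebra k A] {δ : Derivation k A A}

/-- The operator has order at most `N`. -/
def OrdLE (P : PDO δ) (N : ℤ) : Prop := ∀ n, N < n → P.coeff n = 0

theorem exists_ordLE (P : PDO δ) : ∃ N, OrdLE P N := P.bdd

theorem OrdLE.mono {P : PDO δ} {N M : ℤ} (h : OrdLE P N) (hNM : N ≤ M) : OrdLE P M :=
  fun n hn => h n (by omega)

@[simp] theorem coeff_zero (n : ℤ) : (0 : PDO δ).coeff n = 0 := rfl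

@[simp] theorem coeff_add (P Q : PDO δ) (n : ℤ) : (P + Q).coeff n = P.coeff n + Q.coeff n := rfl

@[simp] theorem coeff_neg (P : PDO δ) (n : ℤ) : (-P).coeff n = -P.coeff n := rfl

@[simp] theorem coeff_sub (P Q : PDO δ) (n : ℤ) : (P - Q).coeff n = P.coeff n - Q.coeff n := rfl

theorem coeff_monomial (m n : ℤ) (a : A) :
    (monomial δ m a).coeff n = if n = m then a else 0 := rfl

theorem coeff_one (n : ℤ) : (1 : PDO δ).coeff n = if n = 0 then 1 else 0 := rfl

/-- The coefficient of `D^n` as an additive map. -/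
@[simps] def coeffHom (δ : Derivation k A A) (n : ℤ) : PDO δ →+ A where
  toFun P := P.coeff n
  map_zero' := rfl
  map_add' _ _ := rfl

@[simp] theorem coeff_sum {ι : Type*} (s : Finset ι) (f : ι → PDO δ) (n : ℤ) :
    (∑ i ∈ s, f i).coeff n = ∑ i ∈ s, (f i).coeff n := map_sum (coeffHom δ n) f s

theorem OrdLE.zero (N : ℤ) : OrdLE (0 : PDO δ) N := fun _ _ => rfl

theorem OrdLE.add {P Q : PDO δ} {N : ℤ} (hP : OrdLE P N) (hQ : OrdLE Q N) : OrdLE (P + Q) N :=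
  fun n hn => by rw [coeff_add, hP n hn, hQ n hn, add_zero]

theorem OrdLE.neg {P : PDO δ} {N : ℤ} (hP : OrdLE P N) : OrdLE (-P) N :=
  fun n hn => by rw [coeff_neg, hP n hn, neg_zero]

theorem OrdLE.sub {P Q : PDO δ} {N : ℤ} (hP : OrdLE P N) (hQ : OrdLE Q N) : OrdLE (P - Q) N :=
  fun n hn => by rw [coeff_sub, hP n hn, hQ n hn, sub_zero]

theorem ordLE_monomial (m : ℤ) (a : A) : OrdLE (monomial δ m a) m :=
  fun n hn => by rw [coeff_monomial, if_neg (by omega)]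

theorem ordLE_C (a : A) : OrdLE (C δ a) 0 := ordLE_monomial 0 a

theorem ordLE_D (m : ℤ) : OrdLE (D δ m) m := ordLE_monomial m 1

theorem ordLE_one : OrdLE (1 : PDO δ) 0 := ordLE_monomial 0 1

theorem eq_zero_of_forall_ordLE {P : PDO δ} (h : ∀ N, OrdLE P N) : P = 0 :=
  PDO.ext (funext fun n => h (n - 1) n (by omega))

/-- An additive map which vanishes on monomials and on operators of sufficiently low order is
zero. -/
theorem eq_zero_of_monomial {B : Type*} [AddCommGroup B] (F : PDO δ →+ B)
    (hF : ∃ K, ∀ P, OrdLE P K → F P = 0) (hm : ∀ i a, F (monomial δ i a) = 0) (P : PDO δ) :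
    F P = 0 := by
  obtain ⟨K, hK⟩ := hF
  have key : ∀ (n : ℕ) (P : PDO δ), OrdLE P (K + n) → F P = 0 := by
    intro n
    induction n with
    | zero => intro P hP; exact hK P (by simpa using hP)
    | succ n ih =>
      intro P hP
      -- Subtracting the top term lowers the order by one, until it reaches the bound `K` below
      -- which `F` vanishes.
      have h1 : OrdLE (P - monomial δ (K + (n + 1 : ℕ)) (P.coeff (K + (n + 1 : ℕ)))) (K + n) := by
        intro m hm
        rw [coeff_sub, coeff_monomial]
        split_ifs with h
        · rw [h, sub_self]
        · rw [hP m (by push_cast at h ⊢; omega), sub_zero]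
      have := ih _ h1
      rwa [map_sub, hm, sub_zero] at this
  obtain ⟨N, hN⟩ := P.bdd
  exact key (N - K).toNat P (OrdLE.mono hN (by omega))

theorem coeff_mul (P Q : PDO δ) (n : ℤ) : (P * Q).coeff n =
    ∑ᶠ p : ℤ × ℕ, Ring.choose p.1 p.2 • (P.coeff p.1 * δ^[p.2] (Q.coeff (n - p.1 + p.2))) := rfl

theorem iterate_map_add (r : ℕ) (a b : A) : δ^[r] (a + b) = δ^[r] a + δ^[r] b :=
  _root_.iterate_map_add δ r a b

/-- The coefficients of a product as finite sums. -/
theorem coeff_mul_eq_sum {P Q : PDO δ} {N M n : ℤ} (hP : OrdLE P N) (hQ : OrdLE Q M)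
    {lo : ℤ} {B : ℕ} (hlo : lo ≤ n - M) (hB : N + M - n < B) :
    (P * Q).coeff n = ∑ i ∈ Finset.Icc lo N, ∑ r ∈ Finset.range B,
      Ring.choose i r • (P.coeff i * δ^[r] (Q.coeff (n - i + r))) := by
  rw [coeff_mul, ← Finset.sum_product', finsum_eq_sum_of_support_subset]
  intro p hp
  rw [Function.mem_support] at hp
  have h1 : p.1 ≤ N := by
    by_contra h
    rw [hP _ (by omega), zero_mul, smul_zero] at hp
    exact hp rfl
  have h2 : n - p.1 + p.2 ≤ M := by
    by_contra h
    rw [hQ _ (by omega), iterate_map_zero, mul_zero, smul_zero] at hp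
    exact hp rfl
  simp only [Finset.coe_product, Set.mem_prod, Finset.coe_Icc, Set.mem_Icc, Finset.coe_range,
    Set.mem_Iio]
  omega

theorem OrdLE.mul {P Q : PDO δ} {N M : ℤ} (hP : OrdLE P N) (hQ : OrdLE Q M) :
    OrdLE (P * Q) (N + M) := by
  intro n hn
  rw [coeff_mul]
  refine finsum_eq_zero_of_forall_eq_zero fun p => ?_
  rcases lt_or_ge N p.1 with h | h
  · rw [hP _ h, zero_mul, smul_zero]
  · rw [hQ _ (by omega), iterate_map_zero, mul_zero, smul_zero]

protected theorem left_distrib' (P Q R : PDO δ) : P * (Q + R) = P * Q + P * R := by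
  obtain ⟨N, hN⟩ := P.exists_ordLE
  obtain ⟨M₁, hM₁⟩ := Q.exists_ordLE
  obtain ⟨M₂, hM₂⟩ := R.exists_ordLE
  have h1 := hM₁.mono (le_max_left M₁ M₂)
  have h2 := hM₂.mono (le_max_right M₁ M₂)
  ext n
  have hlo := le_refl (n - max M₁ M₂)
  have hB : N + max M₁ M₂ - n < ((N + max M₁ M₂ - n).toNat + 1 : ℕ) := by omega
  rw [coeff_add, coeff_mul_eq_sum hN (h1.add h2) hlo hB, coeff_mul_eq_sum hN h1 hlo hB,
    coeff_mul_eq_sum hN h2 hlo hB]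
  simp only [← Finset.sum_add_distrib, coeff_add, iterate_map_add, mul_add, smul_add]

protected theorem right_distrib' (P Q R : PDO δ) : (P + Q) * R = P * R + Q * R := by
  obtain ⟨N, hN⟩ := R.exists_ordLE
  obtain ⟨M₁, hM₁⟩ := P.exists_ordLE
  obtain ⟨M₂, hM₂⟩ := Q.exists_ordLE
  have h1 := hM₁.mono (le_max_left M₁ M₂)
  have h2 := hM₂.mono (le_max_right M₁ M₂)
  ext n
  have hlo := le_refl (n - N)
  have hB : max M₁ M₂ + N - n < ((max M₁ M₂ + N - n).toNat + 1 : ℕ) := by omega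
  rw [coeff_add, coeff_mul_eq_sum (h1.add h2) hN hlo hB, coeff_mul_eq_sum h1 hN hlo hB,
    coeff_mul_eq_sum h2 hN hlo hB]
  simp only [← Finset.sum_add_distrib, coeff_add, add_mul, smul_add]

protected theorem zero_mul' (P : PDO δ) : 0 * P = 0 := by
  have := PDO.right_distrib' 0 0 P
  rwa [add_zero, left_eq_add] at this

protected theorem mul_zero' (P : PDO δ) : P * 0 = 0 := by
  have := PDO.left_distrib' P 0 0
  rwa [add_zero, left_eq_add] at this

theorem coeff_monomial_mul {Q : PDO δ} {M i n : ℤ} (hQ : OrdLE Q M) (a : A)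
    {B : ℕ} (hB : i + M - n < B) : (monomial δ i a * Q).coeff n =
      ∑ r ∈ Finset.range B, Ring.choose i r • (a * δ^[r] (Q.coeff (n - i + r))) := by
  rw [coeff_mul_eq_sum (lo := min i (n - M)) (ordLE_monomial i a) hQ (min_le_right _ _) hB,
    Finset.sum_eq_single i]
  · simp [coeff_monomial]
  · intro j _ hj
    simp [coeff_monomial, hj]
  · intro h
    exact absurd (Finset.mem_Icc.2 ⟨min_le_left _ _, le_rfl⟩) h

theorem coeff_C_mul (a : A) (Q : PDO δ) (n : ℤ) : (C δ a * Q).coeff n = a * Q.coeff n := by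
  obtain ⟨M, hM⟩ := Q.exists_ordLE
  rw [C, coeff_monomial_mul hM a (B := (M - n).toNat + 1) (by omega), Finset.sum_range_succ',
    Finset.sum_eq_zero]
  · simp
  · intro r _
    rw [Ring.choose_zero_succ, zero_smul]

theorem coeff_D_one_mul (Q : PDO δ) (n : ℤ) :
    (D δ 1 * Q).coeff n = δ (Q.coeff n) + Q.coeff (n - 1) := by
  obtain ⟨M, hM⟩ := Q.exists_ordLE
  rw [D, coeff_monomial_mul hM 1 (B := (1 + M - n).toNat + 2) (by omega),
    Finset.sum_range_succ', Finset.sum_range_succ', Finset.sum_eq_zero]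
  · simp
  · intro r _
    have : Ring.choose (1 : ℤ) (r + 1 + 1) = 0 := by
      have := Ring.choose_natCast (R := ℤ) 1 (r + 1 + 1)
      rw [Nat.cast_one] at this
      rw [this, Nat.choose_eq_zero_of_lt (by omega), Nat.cast_zero]
    rw [this, zero_smul]

theorem monomial_mul_eq (i : ℤ) (a : A) (Q : PDO δ) :
    monomial δ i a * Q = C δ a * (D δ i * Q) := by
  obtain ⟨M, hM⟩ := Q.exists_ordLE
  ext n
  have hB : i + M - n < ((i + M - n).toNat + 1 : ℕ) := by omega
  rw [coeff_C_mul, D, coeff_monomial_mul hM a hB, coeff_monomial_mul hM 1 hB, Finset.mul_sum]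
  simp only [one_mul, mul_smul_comm]

theorem C_mul_C_mul (a b : A) (Q : PDO δ) : C δ a * (C δ b * Q) = C δ (a * b) * Q := by
  ext n
  simp only [coeff_C_mul, mul_assoc]

/-- This is Pascal's rule for binomial coefficients with an arbitrary integer upper entry. -/
theorem D_one_mul_D_mul (i : ℤ) (Q : PDO δ) : D δ 1 * (D δ i * Q) = D δ (i + 1) * Q := by
  obtain ⟨M, hM⟩ := Q.exists_ordLE
  ext n
  set B := (i + 1 + M - n).toNat + 1 with hB
  rw [coeff_D_one_mul, D, D, coeff_monomial_mul hM 1 (B := B) (by omega),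
    coeff_monomial_mul hM 1 (B := B + 1) (by omega),
    coeff_monomial_mul hM 1 (B := B + 1) (by omega), Finset.sum_range_succ' _ B,
    Finset.sum_range_succ' _ B, map_sum, ← add_assoc, ← Finset.sum_add_distrib]
  congr 1
  · refine Finset.sum_congr rfl fun r _ => ?_
    rw [Ring.choose_succ_succ i r, add_smul, ← Nat.succ_eq_add_one r]
    simp only [one_mul, map_zsmul, Function.iterate_succ', Function.comp_apply]
    congr 5 <;> push_cast <;> ring_nf
  · simp only [Ring.choose_zero_right, one_smul, Function.iterate_zero, id, one_mul]
    congr 1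
    push_cast
    ring

theorem D_one_mul_C_mul (b : A) (Q : PDO δ) :
    D δ 1 * (C δ b * Q) = C δ (δ b) * Q + C δ b * (D δ 1 * Q) := by
  ext n
  simp only [coeff_D_one_mul, coeff_C_mul, coeff_add, Derivation.leibniz, smul_eq_mul]
  ring

/-- The coefficient of `D^{n+1}` in `D P` is that of `D^n` in `P` plus a derivative of a higher one,
so the coefficients vanish successively from the top. Cancelling a left factor `D` is how identities
are carried over to negative powers. -/
theorem D_one_mul_injective {P : PDO δ} (h : D δ 1 * P = 0) : P = 0 := by
  obtain ⟨N, hN⟩ := P.exists_ordLE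
  have step : ∀ m : ℕ, OrdLE P (N - m) := by
    intro m
    induction m with
    | zero => simpa using hN
    | succ m ih =>
      intro n hn
      rcases lt_or_ge (N - m) n with h' | h'
      · exact ih n h'
      · have h1 : (D δ 1 * P).coeff (n + 1) = 0 := by rw [h]; rfl
        rw [coeff_D_one_mul, ih (n + 1) (by push_cast at hn; omega), map_zero, zero_add] at h1
        simpa using h1
  refine eq_zero_of_forall_ordLE fun M => (step (N - M).toNat).mono (by omega)

/-- Left multiplication as an additive map. -/
@[simps] noncomputable def mulLeftHom (P : PDO δ) : PDO δ →+ PDO δ where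
  toFun Q := P * Q
  map_zero' := PDO.mul_zero' P
  map_add' := PDO.left_distrib' P

/-- Right multiplication as an additive map. -/
@[simps] noncomputable def mulRightHom (P : PDO δ) : PDO δ →+ PDO δ where
  toFun Q := Q * P
  map_zero' := PDO.zero_mul' P
  map_add' Q R := PDO.right_distrib' Q R P

protected theorem mul_sub' (P Q R : PDO δ) : P * (Q - R) = P * Q - P * R :=
  map_sub (mulLeftHom P) Q R

/-- To show `F = G` for additive operator-valued maps which are bounded in order, it suffices to
look at monomials. -/
theorem eq_of_monomial (F G : PDO δ →+ PDO δ) (c : ℤ)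
    (hF : ∀ P K, OrdLE P K → OrdLE (F P) (K + c)) (hG : ∀ P K, OrdLE P K → OrdLE (G P) (K + c))
    (hm : ∀ i a, F (monomial δ i a) = G (monomial δ i a)) (P : PDO δ) : F P = G P := by
  ext n
  have := eq_zero_of_monomial ((coeffHom δ n).comp (F - G)) ⟨n - c - 1, fun Q hQ => ?_⟩
    (fun i a => ?_) P
  · simpa [sub_eq_zero] using this
  · have h1 := hF Q _ hQ n (by omega)
    have h2 := hG Q _ hQ n (by omega)
    simp [h1, h2]
  · simp [hm]

theorem C_mul_mul (a : A) (Q R : PDO δ) : (C δ a * Q) * R = C δ a * (Q * R) := by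
  obtain ⟨M, hM⟩ := R.exists_ordLE
  refine eq_of_monomial ((mulRightHom R).comp (mulLeftHom (C δ a)))
    ((mulLeftHom (C δ a)).comp (mulRightHom R)) M (fun P K hP => ?_) (fun P K hP => ?_)
    (fun i b => ?_) Q
  · have := ((ordLE_C a).mul hP).mul hM
    exact this.mono (by omega)
  · have := (ordLE_C a).mul (hP.mul hM)
    exact this.mono (by omega)
  · have : C δ a * monomial δ i b = monomial δ i (a * b) := by
      ext n
      rw [coeff_C_mul, coeff_monomial, coeff_monomial]
      split_ifs <;> simp
    simp only [AddMonoidHom.comp_apply, mulLeftHom_apply, mulRightHom_apply]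
    rw [this, monomial_mul_eq, monomial_mul_eq, C_mul_C_mul]

theorem D_one_mul_mul (Q R : PDO δ) : (D δ 1 * Q) * R = D δ 1 * (Q * R) := by
  obtain ⟨M, hM⟩ := R.exists_ordLE
  refine eq_of_monomial ((mulRightHom R).comp (mulLeftHom (D δ 1)))
    ((mulLeftHom (D δ 1)).comp (mulRightHom R)) (M + 1) (fun P K hP => ?_) (fun P K hP => ?_)
    (fun i b => ?_) Q
  · have := ((ordLE_D 1).mul hP).mul hM
    exact this.mono (by omega)
  · have := (ordLE_D 1).mul (hP.mul hM)
    exact this.mono (by omega)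
  · have : D δ 1 * monomial δ i b = monomial δ i (δ b) + monomial δ (i + 1) b := by
      ext n
      simp only [coeff_D_one_mul, coeff_add, coeff_monomial, sub_eq_iff_eq_add]
      split_ifs <;> simp
    simp only [AddMonoidHom.comp_apply, mulLeftHom_apply, mulRightHom_apply]
    rw [this, PDO.right_distrib', monomial_mul_eq, monomial_mul_eq, monomial_mul_eq,
      D_one_mul_C_mul, D_one_mul_D_mul]

protected theorem one_mul' (P : PDO δ) : 1 * P = P := by
  ext n
  change (C δ 1 * P).coeff n = _
  rw [coeff_C_mul, one_mul]

theorem D_mul_mul (i : ℤ) (Q R : PDO δ) : (D δ i * Q) * R = D δ i * (Q * R) := by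
  induction i with
  | zero =>
    change (1 * Q) * R = 1 * (Q * R)
    rw [PDO.one_mul', PDO.one_mul']
  | succ i ih => rw [← D_one_mul_D_mul, ← D_one_mul_D_mul, D_one_mul_mul, ih]
  | pred i ih =>
    rw [← sub_eq_zero]
    apply D_one_mul_injective
    rw [PDO.mul_sub', ← D_one_mul_mul, D_one_mul_D_mul, D_one_mul_D_mul, sub_add_cancel, ih,
      sub_self]

/-- Both sides are additive in `P` and raise its order by a bounded amount, so a left factor `a D^i`
suffices; it splits into `a` and `D^i`, which are treated separately. -/
protected theorem mul_assoc' (P Q R : PDO δ) : (P * Q) * R = P * (Q * R) := by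
  obtain ⟨N, hN⟩ := Q.exists_ordLE
  obtain ⟨M, hM⟩ := R.exists_ordLE
  refine eq_of_monomial ((mulRightHom R).comp (mulRightHom Q))
    (mulRightHom (Q * R)) (N + M) (fun P K hP => ?_) (fun P K hP => ?_)
    (fun i b => ?_) P
  · have := (hP.mul hN).mul hM
    exact this.mono (by omega)
  · exact hP.mul (hN.mul hM)
  · simp only [AddMonoidHom.comp_apply, mulRightHom_apply]
    rw [monomial_mul_eq, monomial_mul_eq, C_mul_mul, D_mul_mul]

theorem monomial_mul_C (i : ℤ) (a b : A) (n : ℤ) (r : ℕ) (h : n + r = i) :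
    (monomial δ i a * C δ b).coeff n = Ring.choose i r • (a * δ^[r] b) := by
  rw [coeff_monomial_mul (ordLE_C b) a (B := r + 1) (by omega), Finset.sum_eq_single r]
  · rw [C, coeff_monomial, if_pos (by omega)]
  · intro q _ hq
    rw [C, coeff_monomial, if_neg (by omega), iterate_map_zero, mul_zero, smul_zero]
  · intro h
    exact absurd (Finset.mem_range.2 (Nat.lt_succ_self r)) h

theorem coeff_mul_monomial_of_map_eq_zero (P : PDO δ) (m : ℤ) (b : A) (hb : δ b = 0) (n : ℤ) :
    (P * monomial δ m b).coeff n = P.coeff (n - m) * b := by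
  have hr : ∀ r : ℕ, 0 < r → δ^[r] b = 0 := by
    intro r hr
    obtain ⟨r, rfl⟩ := Nat.exists_eq_succ_of_ne_zero hr.ne'
    rw [Function.iterate_succ_apply, hb, iterate_map_zero]
  rw [coeff_mul, finsum_eq_single _ ((n - m, 0) : ℤ × ℕ)]
  · simp [coeff_monomial]
  · rintro ⟨i, r⟩ hir
    simp only [coeff_monomial]
    split_ifs with h
    · rcases Nat.eq_zero_or_pos r with rfl | h'
      · exfalso; apply hir; ext
        · simp at h ⊢; omega
        · rfl
      · rw [hr r h', mul_zero, smul_zero]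
    · rw [iterate_map_zero, mul_zero, smul_zero]

theorem coeff_mul_D (P : PDO δ) (m n : ℤ) : (P * D δ m).coeff n = P.coeff (n - m) := by
  rw [D, coeff_mul_monomial_of_map_eq_zero P m 1 (Derivation.map_one_eq_zero δ), mul_one]

protected theorem mul_one' (P : PDO δ) : P * 1 = P := by
  ext n
  change (P * D δ 0).coeff n = _
  rw [coeff_mul_D, sub_zero]

noncomputable instance : Ring (PDO δ) where
  left_distrib := PDO.left_distrib'
  right_distrib := PDO.right_distrib'
  zero_mul := PDO.zero_mul'
  mul_zero := PDO.mul_zero'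
  mul_assoc := PDO.mul_assoc'
  one_mul := PDO.one_mul'
  mul_one := PDO.mul_one'
  neg_add_cancel := neg_add_cancel
  sub_eq_add_neg := sub_eq_add_neg
  zsmul := zsmulRec

theorem pow_eq (P : PDO δ) (n : ℕ) : P.pow n = P ^ n := by
  induction n with
  | zero => rw [pow_zero]; rfl
  | succ n ih => rw [pow_succ, ← ih]; rfl

theorem monomial_eq (i : ℤ) (a : A) : monomial δ i a = C δ a * D δ i := by
  have := monomial_mul_eq i a (1 : PDO δ)
  rwa [mul_one, mul_one] at this

theorem C_mul_C (a b : A) : C δ a * C δ b = C δ (a * b) := by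
  have := C_mul_C_mul a b (1 : PDO δ)
  rwa [mul_one, mul_one] at this

theorem D_mul_D (i j : ℤ) : D δ i * D δ j = D δ (i + j) := by
  ext n
  rw [coeff_mul_D, D, D, coeff_monomial, coeff_monomial]
  simp only [sub_eq_iff_eq_add]

theorem D_zero : D δ 0 = 1 := rfl

theorem C_one : C δ 1 = 1 := rfl

theorem C_add (a b : A) : C δ (a + b) = C δ a + C δ b := by
  ext n
  simp only [C, coeff_monomial, coeff_add]
  split_ifs <;> simp

theorem C_neg (a : A) : C δ (-a) = -C δ a := by
  ext n
  simp only [C, coeff_monomial, coeff_neg]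
  split_ifs <;> simp

theorem C_sum {ι : Type*} (s : Finset ι) (f : ι → A) : C δ (∑ i ∈ s, f i) = ∑ i ∈ s, C δ (f i) := by
  ext n
  simp only [C, coeff_monomial, coeff_sum]
  split_ifs <;> simp

theorem D_one_mul_C (b : A) : D δ 1 * C δ b = C δ (δ b) + C δ b * D δ 1 := by
  have := D_one_mul_C_mul b (1 : PDO δ)
  rwa [mul_one, mul_one, mul_one] at this

theorem D_one_mul_D_neg_one_mul (Q : PDO δ) : D δ 1 * (D δ (-1) * Q) = Q := by
  rw [← mul_assoc, D_mul_D, add_neg_cancel, D_zero, one_mul]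

end PDO

namespace PDO

variable {k A : Type*} [Field k] [CommRing A] [Algebra k A] {δ : Derivation k A A}

/-! ### Leading coefficients, inverses, coefficientwise derivations -/

@[simp] theorem coeff_zsmul (m : ℤ) (P : PDO δ) (n : ℤ) : (m • P).coeff n = m • P.coeff n :=
  map_zsmul (coeffHom δ n) m P

theorem coeff_mul_top {P Q : PDO δ} {N M : ℤ} (hP : OrdLE P N) (hQ : OrdLE Q M) :
    (P * Q).coeff (N + M) = P.coeff N * Q.coeff M := by
  rw [coeff_mul, finsum_eq_single _ ((N, 0) : ℤ × ℕ)]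
  · simp
  · rintro ⟨i, r⟩ hir
    simp only
    rcases lt_or_ge N i with h | h
    · rw [hP _ h, zero_mul, smul_zero]
    · rw [hQ, iterate_map_zero, mul_zero, smul_zero]
      by_contra h'
      apply hir
      ext <;> simp only <;> omega

theorem OrdLE.pow {P : PDO δ} {N : ℤ} (hP : OrdLE P N) (n : ℕ) : OrdLE (P ^ n) (n * N) := by
  induction n with
  | zero => simpa using ordLE_one
  | succ n ih =>
    rw [pow_succ]
    exact (ih.mul hP).mono (by push_cast; linarith)

/-- Completeness for the filtration by order: the coefficient of `D^m` is stationary from step `-m`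
on, and the limit reads it off there. -/
theorem exists_limit (U : ℕ → PDO δ) (h0 : OrdLE (U 0) 0)
    (h : ∀ n : ℕ, OrdLE (U (n + 1) - U n) (-(n + 1))) :
    ∃ V : PDO δ, ∀ n : ℕ, OrdLE (V - U n) (-(n + 1)) := by
  refine ⟨⟨fun m => (U (-m).toNat).coeff m, 0, fun n hn => ?_⟩, fun n m hm => ?_⟩
  · rw [Int.toNat_of_nonpos (by omega)]
    exact h0 n hn
  · rw [coeff_sub, sub_eq_zero]
    have hle : (-m).toNat ≤ n := by omega
    change (U (-m).toNat).coeff m = (U n).coeff m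
    induction n, hle using Nat.le_induction with
    | base => rfl
    | succ n hle ih =>
      rw [ih (by omega), eq_comm, ← sub_eq_zero, ← coeff_sub]
      exact h n m (by omega)

/-- The geometric series in `1 - W` converges, because each power lowers the order further. -/
theorem exists_right_inverse {W : PDO δ} (hW : OrdLE (W - 1) (-1)) :
    ∃ U : PDO δ, W * U = 1 ∧ OrdLE (U - 1) (-1) := by
  have hX : OrdLE (1 - W) (-1) := by simpa using hW.neg
  obtain ⟨V, hV⟩ := exists_limit (fun n => ∑ i ∈ Finset.range (n + 1), (1 - W) ^ i)
    (by simpa using ordLE_one) (fun n => by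
      rw [Finset.sum_range_succ _ (n + 1), add_sub_cancel_left]
      exact (hX.pow _).mono (by push_cast; linarith))
  have hW0 : OrdLE W 0 := by simpa using (hW.mono (by omega : (-1 : ℤ) ≤ 0)).add ordLE_one
  refine ⟨V, ?_, by simpa using hV 0⟩
  rw [← sub_eq_zero]
  refine eq_zero_of_forall_ordLE fun N => ?_
  have h1 : W * V - 1 = W * (V - ∑ i ∈ Finset.range ((-N).toNat + 1), (1 - W) ^ i) -
      (1 - W) ^ ((-N).toNat + 1) := by
    have := mul_neg_geom_sum (1 - W) ((-N).toNat + 1)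
    rw [sub_sub_cancel] at this
    rw [mul_sub, this]
    abel
  rw [h1]
  exact ((hW0.mul (hV _)).mono (by omega)).sub ((hX.pow _).mono (by push_cast; omega))

/-- An operator `1 + O(D⁻¹)` has a two-sided inverse of the same form. -/
theorem exists_inverse {W : PDO δ} (hW : OrdLE (W - 1) (-1)) :
    ∃ U : PDO δ, W * U = 1 ∧ U * W = 1 ∧ OrdLE (U - 1) (-1) := by
  obtain ⟨U, hWU, hU⟩ := exists_right_inverse hW
  obtain ⟨V, hUV, -⟩ := exists_right_inverse hU
  have : V = W := by rw [← one_mul V, ← hWU, mul_assoc, hUV, mul_one]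
  exact ⟨U, hWU, this ▸ hUV, hU⟩

theorem ordLE_zero_of_sub_one {W : PDO δ} (hW : OrdLE (W - 1) (-1)) : OrdLE W 0 := by
  simpa using (hW.mono (by omega : (-1 : ℤ) ≤ 0)).add ordLE_one

theorem coeff_deriv (d : Derivation k A A) (P : PDO δ) (n : ℤ) :
    (deriv d P).coeff n = d (P.coeff n) := rfl

theorem OrdLE.deriv {P : PDO δ} {N : ℤ} (hP : OrdLE P N) (d : Derivation k A A) :
    OrdLE (PDO.deriv d P) N := fun n hn => by rw [coeff_deriv, hP n hn, map_zero]

theorem deriv_mul {d : Derivation k A A} (hd : ∀ a, d (δ a) = δ (d a)) (P Q : PDO δ) :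
    deriv d (P * Q) = deriv d P * Q + P * deriv d Q := by
  obtain ⟨N, hN⟩ := P.exists_ordLE
  obtain ⟨M, hM⟩ := Q.exists_ordLE
  have hit : ∀ (r : ℕ) (a : A), d (δ^[r] a) = δ^[r] (d a) := by
    intro r
    induction r with
    | zero => intro a; rfl
    | succ r ih => intro a; rw [Function.iterate_succ_apply, ih, hd, Function.iterate_succ_apply]
  ext n
  have hB : N + M - n < ((N + M - n).toNat + 1 : ℕ) := by omega
  rw [coeff_add, coeff_deriv, coeff_mul_eq_sum hN hM le_rfl hB,
    coeff_mul_eq_sum (hN.deriv d) hM le_rfl hB, coeff_mul_eq_sum hN (hM.deriv d) le_rfl hB, map_sum,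
    ← Finset.sum_add_distrib]
  refine Finset.sum_congr rfl fun i _ => ?_
  rw [map_sum, ← Finset.sum_add_distrib]
  refine Finset.sum_congr rfl fun r _ => ?_
  rw [map_zsmul, Derivation.leibniz, coeff_deriv, coeff_deriv, hit, ← smul_add]
  simp only [smul_eq_mul]
  ring_nf

theorem deriv_D (d : Derivation k A A) (m : ℤ) : deriv d (D δ m) = 0 := by
  ext n
  rw [coeff_deriv, D, coeff_monomial]
  split_ifs <;> simp

theorem deriv_C (d : Derivation k A A) (a : A) : deriv d (C δ a) = C δ (d a) := by
  ext n
  rw [coeff_deriv, C, C, coeff_monomial, coeff_monomial]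
  split_ifs <;> simp

/-- Commutation with `D`: `D P - P D` is the coefficientwise derivative. -/
theorem D_one_mul_eq (P : PDO δ) : D δ 1 * P = deriv δ P + P * D δ 1 := by
  ext n
  rw [coeff_D_one_mul, coeff_add, coeff_deriv, coeff_mul_D]

theorem plus_add_minus (P : PDO δ) : P.plus + P.minus = P := by
  ext n
  simp only [plus, minus, coeff_add]
  split_ifs <;> simp

theorem ordLE_minus (P : PDO δ) : OrdLE P.minus (-1) := fun n hn => if_pos (by omega)

/-! ### Differential operators -/

/-- The operator has no negative part. -/
def IsDiff (P : PDO δ) : Prop := ∀ n < 0, P.coeff n = 0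

theorem isDiff_C (a : A) : IsDiff (C δ a) := fun _ hn => if_neg (by omega)

theorem isDiff_D (m : ℕ) : IsDiff (D δ m) := fun _ hn => if_neg (by omega)

theorem IsDiff.sub {P Q : PDO δ} (hP : IsDiff P) (hQ : IsDiff Q) : IsDiff (P - Q) :=
  fun n hn => by rw [coeff_sub, hP n hn, hQ n hn, sub_zero]

theorem IsDiff.sum {ι : Type*} {s : Finset ι} {f : ι → PDO δ} (h : ∀ i ∈ s, IsDiff (f i)) :
    IsDiff (∑ i ∈ s, f i) := fun n hn => by
  rw [coeff_sum]
  exact Finset.sum_eq_zero fun i hi => h i hi n hn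

/-- For `0 ≤ i < r` the binomial coefficient `binom(i, r)` is zero, so the Leibniz rule never
reaches a negative power. -/
theorem IsDiff.mul {P Q : PDO δ} (hP : IsDiff P) (hQ : IsDiff Q) : IsDiff (P * Q) := by
  intro n hn
  rw [coeff_mul]
  refine finsum_eq_zero_of_forall_eq_zero fun p => ?_
  obtain ⟨i, r⟩ := p
  simp only
  rcases lt_or_ge i 0 with h | h
  · rw [hP _ h, zero_mul, smul_zero]
  · obtain ⟨i, rfl⟩ := Int.eq_ofNat_of_zero_le h
    rcases lt_or_ge i r with h' | h'
    · rw [Ring.choose_natCast, Nat.choose_eq_zero_of_lt h', Nat.cast_zero, zero_smul]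
    · rw [hQ _ (by omega), iterate_map_zero, mul_zero, smul_zero]

theorem OrdLE.res_eq_zero {P : PDO δ} (hP : OrdLE P (-2)) : P.res = 0 := hP (-1) (by omega)

theorem res_add (P Q : PDO δ) : (P + Q).res = P.res + Q.res := rfl

theorem res_sub (P Q : PDO δ) : (P - Q).res = P.res - Q.res := rfl

/-! ### The action of differential operators and the adjoint -/

theorem applyPlus_support_finite (P : PDO δ) (f : A) :
    (Function.support fun n : ℕ => P.coeff n * δ^[n] f).Finite := by
  obtain ⟨N, hN⟩ := P.exists_ordLE
  refine (Finset.range (N.toNat + 1)).finite_toSet.subset fun n hn => ?_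
  rw [Function.mem_support] at hn
  by_contra h
  simp only [Finset.coe_range, Set.mem_Iio, not_lt] at h
  exact hn (by rw [hN _ (by omega), zero_mul])

theorem applyPlus_add (P Q : PDO δ) (f : A) :
    (P + Q).applyPlus f = P.applyPlus f + Q.applyPlus f := by
  unfold applyPlus
  rw [← finsum_add_distrib (P.applyPlus_support_finite f) (Q.applyPlus_support_finite f)]
  simp only [coeff_add, add_mul]

/-- `P_+(f)` as a residue. -/
theorem applyPlus_eq_res (P : PDO δ) (f : A) :
    P.applyPlus f = (P * (C δ f * D δ (-1))).res := by
  let F : PDO δ →+ A :=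
    { toFun := fun P => P.applyPlus f - (P * (C δ f * D δ (-1))).res
      map_zero' := by
        rw [zero_mul]
        simp [applyPlus, res]
      map_add' := fun P Q => by
        rw [applyPlus_add, add_mul, res_add]
        abel }
  rw [← sub_eq_zero]
  refine eq_zero_of_monomial F ⟨-1, fun P hP => ?_⟩ (fun i a => ?_) P
  · have h1 : P.applyPlus f = 0 :=
      finsum_eq_zero_of_forall_eq_zero fun n => by rw [hP n (by omega), zero_mul]
    have h2 : (P * (C δ f * D δ (-1))).res = 0 :=
      (hP.mul ((ordLE_C f).mul (ordLE_D (-1)))).res_eq_zero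
    change P.applyPlus f - (P * (C δ f * D δ (-1))).res = 0
    rw [h1, h2, sub_zero]
  · change (monomial δ i a).applyPlus f - (monomial δ i a * (C δ f * D δ (-1))).res = 0
    rw [sub_eq_zero, ← mul_assoc, res, coeff_mul_D, show (-1 - -1 : ℤ) = 0 from rfl]
    rcases lt_or_ge i 0 with h | h
    · rw [((ordLE_monomial i a).mul (ordLE_C f)) 0 (by omega)]
      exact finsum_eq_zero_of_forall_eq_zero fun n => by
        rw [coeff_monomial, if_neg (by omega), zero_mul]
    · obtain ⟨i, rfl⟩ := Int.eq_ofNat_of_zero_le h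
      rw [monomial_mul_C _ _ _ 0 i (by simp), Ring.choose_natCast, Nat.choose_self, Nat.cast_one,
        one_smul, applyPlus, finsum_eq_single _ i]
      · rw [coeff_monomial, if_pos rfl]
      · intro n hn
        rw [coeff_monomial, if_neg (by simpa using hn), zero_mul]

theorem coeff_adjoint (P : PDO δ) (m : ℤ) : P.adjoint.coeff m = ∑ᶠ r : ℕ,
    (((m + r).negOnePow : ℤ) * Ring.choose (m + r) r) • δ^[r] (P.coeff (m + r)) := rfl

theorem adjoint_support_finite (P : PDO δ) (m : ℤ) : (Function.support fun r : ℕ =>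
    (((m + r).negOnePow : ℤ) * Ring.choose (m + r) r) • δ^[r] (P.coeff (m + r))).Finite := by
  obtain ⟨N, hN⟩ := P.exists_ordLE
  refine (Finset.range ((N - m).toNat + 1)).finite_toSet.subset fun n hn => ?_
  rw [Function.mem_support] at hn
  by_contra h
  simp only [Finset.coe_range, Set.mem_Iio, not_lt] at h
  exact hn (by rw [hN _ (by omega), iterate_map_zero, smul_zero])

/-- The formal adjoint as an additive map. -/
noncomputable def adjointHom (δ : Derivation k A A) : PDO δ →+ PDO δ where
  toFun := adjoint
  map_zero' := by
    ext m
    rw [coeff_adjoint]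
    exact finsum_eq_zero_of_forall_eq_zero fun r => by
      rw [coeff_zero, iterate_map_zero, smul_zero]
  map_add' P Q := by
    ext m
    rw [coeff_add, coeff_adjoint, coeff_adjoint, coeff_adjoint,
      ← finsum_add_distrib (P.adjoint_support_finite m) (Q.adjoint_support_finite m)]
    simp only [coeff_add, iterate_map_add, smul_add]

theorem adjointHom_apply (P : PDO δ) : adjointHom δ P = P.adjoint := rfl

theorem OrdLE.adjoint {P : PDO δ} {N : ℤ} (hP : OrdLE P N) : OrdLE P.adjoint N := by
  intro m hm
  rw [coeff_adjoint]
  exact finsum_eq_zero_of_forall_eq_zero fun r => by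
    rw [hP _ (by omega), iterate_map_zero, smul_zero]

theorem adjoint_monomial (i : ℤ) (a : A) :
    (monomial δ i a).adjoint = (i.negOnePow : ℤ) • (D δ i * C δ a) := by
  ext m
  rw [coeff_zsmul]
  rcases lt_or_ge i m with h | h
  · rw [(ordLE_monomial i a).adjoint m h, ((ordLE_D i).mul (ordLE_C a)) m (by omega), smul_zero]
  · obtain ⟨r, hr⟩ := Int.eq_ofNat_of_zero_le (sub_nonneg.2 h)
    have hr' : m + (r : ℤ) = i := by omega
    rw [coeff_adjoint, D, monomial_mul_C i 1 a m r hr', finsum_eq_single _ r, one_mul, hr',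
      coeff_monomial, if_pos rfl, smul_smul]
    intro q hq
    rw [coeff_monomial, if_neg (by omega), iterate_map_zero, smul_zero]

theorem adjoint_C_mul (a : A) (P : PDO δ) : (C δ a * P).adjoint = P.adjoint * C δ a := by
  refine eq_of_monomial ((adjointHom δ).comp (mulLeftHom (C δ a)))
    ((mulRightHom (C δ a)).comp (adjointHom δ)) 0 (fun P K hP => ?_) (fun P K hP => ?_)
    (fun i b => ?_) P
  · exact (((ordLE_C a).mul hP).adjoint).mono (by omega)
  · exact (hP.adjoint).mul (ordLE_C a)
  · simp only [AddMonoidHom.comp_apply, mulLeftHom_apply, mulRightHom_apply, adjointHom_apply]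
    rw [monomial_eq, ← mul_assoc, C_mul_C, ← monomial_eq, ← monomial_eq, adjoint_monomial,
      adjoint_monomial, smul_mul_assoc, mul_assoc, C_mul_C, mul_comm a b]

theorem adjoint_D_one_mul (P : PDO δ) : (D δ 1 * P).adjoint = -(P.adjoint * D δ 1) := by
  refine eq_of_monomial ((adjointHom δ).comp (mulLeftHom (D δ 1)))
    (-((mulRightHom (D δ 1)).comp (adjointHom δ))) 1 (fun P K hP => ?_) (fun P K hP => ?_)
    (fun i b => ?_) P
  · exact (((ordLE_D 1).mul hP).adjoint).mono (by omega)
  · exact ((hP.adjoint).mul (ordLE_D 1)).neg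
  · simp only [AddMonoidHom.comp_apply, mulLeftHom_apply, mulRightHom_apply, adjointHom_apply,
      AddMonoidHom.neg_apply]
    have h1 : D δ 1 * monomial δ i b = monomial δ i (δ b) + monomial δ (i + 1) b := by
      rw [monomial_eq, monomial_eq, monomial_eq, ← mul_assoc, D_one_mul_C, add_mul, mul_assoc,
        D_mul_D, add_comm 1 i]
    rw [h1, ← adjointHom_apply, map_add, adjointHom_apply, adjointHom_apply, adjoint_monomial,
      adjoint_monomial, adjoint_monomial, Int.negOnePow_succ, ← D_mul_D, mul_assoc (D δ i),
      D_one_mul_C]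
    simp only [Units.val_neg, neg_smul, mul_add, smul_add, smul_mul_assoc, mul_assoc]
    abel

theorem adjoint_D_mul (i : ℤ) (P : PDO δ) :
    (D δ i * P).adjoint = (i.negOnePow : ℤ) • (P.adjoint * D δ i) := by
  induction i generalizing P with
  | zero => simp [D_zero]
  | succ i ih =>
    rw [add_comm, ← D_mul_D, mul_assoc, adjoint_D_one_mul, ih, add_comm 1, Int.negOnePow_succ,
      smul_mul_assoc, mul_assoc, D_mul_D, D_mul_D, add_comm, Units.val_neg, neg_smul]
  -- The rule for `D` is applied to `D^{-i-1} P` and solved for its adjoint by multiplying by `D⁻¹`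
  -- on the right.
  | pred i ih =>
    have h1 := ih (D δ (-1) * (D δ 1 * P))
    have h2 := adjoint_D_one_mul (D δ (-(i : ℤ) - 1) * P)
    have e1 : D δ 1 * (D δ (-(i : ℤ) - 1) * P) = D δ (-i) * P := by
      rw [← mul_assoc, D_mul_D, add_sub_cancel]
    rw [e1, ih P] at h2
    have h3 : (D δ (-(i : ℤ) - 1) * P).adjoint =
        (D δ (-(i : ℤ) - 1) * P).adjoint * D δ 1 * D δ (-1) := by
      rw [mul_assoc, D_mul_D, add_neg_cancel, D_zero, mul_one]
    rw [h3, ← neg_neg ((D δ (-(i : ℤ) - 1) * P).adjoint * D δ 1), ← h2, Int.negOnePow_sub,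
      Int.negOnePow_one, neg_mul, smul_mul_assoc, mul_assoc, D_mul_D, ← sub_eq_add_neg]
    simp

/-- The adjoint reverses products. -/
theorem adjoint_mul (Q P : PDO δ) : (Q * P).adjoint = P.adjoint * Q.adjoint := by
  obtain ⟨N, hN⟩ := P.exists_ordLE
  refine eq_of_monomial ((adjointHom δ).comp (mulRightHom P))
    ((mulLeftHom P.adjoint).comp (adjointHom δ)) N (fun Q K hQ => ?_) (fun Q K hQ => ?_)
    (fun i b => ?_) Q
  · exact (hQ.mul hN).adjoint
  · exact (hN.adjoint.mul hQ.adjoint).mono (by omega)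
  · simp only [AddMonoidHom.comp_apply, mulLeftHom_apply, mulRightHom_apply, adjointHom_apply]
    rw [adjoint_monomial, monomial_eq, mul_assoc, adjoint_C_mul, adjoint_D_mul, smul_mul_assoc,
      mul_assoc, mul_smul_comm]

theorem adjoint_one : (1 : PDO δ).adjoint = 1 := by
  change (monomial δ 0 1).adjoint = 1
  rw [adjoint_monomial, D_zero, C_one, mul_one, Int.negOnePow_zero, Units.val_one, one_smul]

theorem adjoint_pow (P : PDO δ) (n : ℕ) : (P ^ n).adjoint = P.adjoint ^ n := by
  induction n with
  | zero => rw [pow_zero, pow_zero, adjoint_one]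
  | succ n ih => rw [pow_succ, adjoint_mul, ih, pow_succ']

/-- Every term of the adjoint with `r ≥ 1` carries `binom(r - 1, r) = 0` at `D⁻¹`. -/
theorem res_adjoint (P : PDO δ) : P.adjoint.res = -P.res := by
  rw [res, coeff_adjoint, finsum_eq_single _ 0]
  · simp [res]
  · intro r hr
    obtain ⟨r, rfl⟩ := Nat.exists_eq_succ_of_ne_zero hr
    rw [show (-1 + (r.succ : ℕ) : ℤ) = (r : ℤ) by push_cast; ring, Ring.choose_natCast,
      Nat.choose_succ_self]
    simp

/-- `(P^*)_+(f)` as a residue. -/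
theorem applyPlus_adjoint (P : PDO δ) (f : A) :
    P.adjoint.applyPlus f = (D δ (-1) * (C δ f * P)).res := by
  have h := res_adjoint (D δ (-1) * (C δ f * P))
  rw [adjoint_D_mul, adjoint_C_mul, mul_assoc] at h
  rw [applyPlus_eq_res, ← neg_eq_iff_eq_neg.2 h]
  simp [res]

/-! ### Dressing and uniqueness -/

theorem pow_dressed {W U L : PDO δ} (hWU : W * U = 1) (hL : L * W = W * D δ 1)
    (l : ℕ) : L ^ l = W * D δ l * U := by
  have : ∀ l : ℕ, L ^ l * W = W * D δ l := by
    intro l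
    induction l with
    | zero => rw [pow_zero, Nat.cast_zero, D_zero, one_mul, mul_one]
    | succ l ih =>
      rw [pow_succ', mul_assoc, ih, ← mul_assoc, hL, mul_assoc, D_mul_D, Nat.cast_succ, add_comm]
  rw [← this, mul_assoc, hWU, mul_one]

/-- A dressing operator whose flow is given by a differential operator `M` identifies `(L^s)_+`. -/
theorem plus_pow_of_flow {W U L M : PDO δ} {d : Derivation k A A} {s : ℕ}
    (hWU : W * U = 1) (hW : OrdLE (W - 1) (-1)) (hU : OrdLE (U - 1) (-1))
    (hL : L * W = W * D δ 1) (hM : IsDiff M) (h : deriv d W + W * D δ s = M * W) :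
    (L ^ s).plus = M := by
  -- The leading coefficient of `W` is the constant `1`, so `∂W U` does not reach the differential
  -- part and `L^s = M - ∂W U` has differential part `M`.
  have h1 : OrdLE (deriv d W * U) (-1) := by
    refine (OrdLE.mul (N := -1) (fun n hn => ?_) (ordLE_zero_of_sub_one hU)).mono (by omega)
    have := hW n hn
    rw [coeff_sub, sub_eq_zero, coeff_one] at this
    rw [coeff_deriv, this]
    split_ifs <;> simp
  have h2 : deriv d W * U + L ^ s = M := by
    rw [pow_dressed hWU hL, ← add_mul, h, mul_assoc, hWU, mul_one]
  ext n
  simp only [plus]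
  split_ifs with hn
  · rw [← h2, coeff_add, h1 n (by omega), zero_add]
  · rw [hM n (by omega)]

/-- The flow reads `∂W = (M - L^s) W`, so `L` moves by the commutator with `M - L^s`, and `L^s`
commutes with `L`. -/
theorem lax_of_flow {W U L M : PDO δ} {d : Derivation k A A} {s : ℕ}
    (hd : ∀ a, d (δ a) = δ (d a)) (hWU : W * U = 1) (hUW : U * W = 1)
    (hL : L * W = W * D δ 1) (h : deriv d W + W * D δ s = M * W) :
    deriv d L = M * L - L * M := by
  have h1 : deriv d W = (M - L ^ s) * W := by
    rw [sub_mul, ← h, pow_dressed hWU hL, mul_assoc, mul_assoc]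
    rw [hUW, mul_one, add_sub_cancel_right]
  have h2 := congrArg (deriv d) hL
  rw [deriv_mul hd, deriv_mul hd, deriv_D, mul_zero, add_zero, h1] at h2
  have h3 : deriv d L * W = ((M - L ^ s) * L - L * (M - L ^ s)) * W := by
    rw [sub_mul, mul_assoc _ L W, hL, ← mul_assoc, ← h2, ← mul_assoc, add_sub_cancel_right]
  have h4 := congrArg (· * U) h3
  simp only [mul_assoc, hWU, mul_one] at h4
  rw [h4, sub_mul, mul_sub, ← pow_succ, ← pow_succ']
  abel

/-- A normalized operator is determined by the differential parts of its powers. -/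
theorem eq_of_plus_pow_eq [Algebra ℚ A] {L L' : PDO δ} (h1 : OrdLE L 1) (h1' : OrdLE L' 1)
    (hc : L.coeff 1 = 1) (hc' : L'.coeff 1 = 1)
    (h : ∀ s, 1 ≤ s → (L ^ s).plus = (L' ^ s).plus) : L = L' := by
  have htop : ∀ s : ℕ, OrdLE (L ^ s) s ∧ (L ^ s).coeff s = 1 := by
    intro s
    induction s with
    | zero => exact ⟨by simpa using ordLE_one, by simp [coeff_one]⟩
    | succ s ih =>
      rw [pow_succ, Nat.cast_succ]
      exact ⟨ih.1.mul h1, by rw [coeff_mul_top ih.1 h1, ih.2, hc, one_mul]⟩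
  have key : ∀ n : ℕ, OrdLE (L - L') (1 - n) := by
    intro n
    induction n with
    | zero => exact (h1.sub h1').mono (by simp)
    | succ n ih =>
      -- If `L` and `L'` agree above `D^{1-n}`, the first possible discrepancy of their `s`-th
      -- powers is `s` times that of `L - L'`. For `s = n ≥ 1` it sits at `D^0`, where the
      -- differential parts agree; `n = 0` is the common normalization.
      have hdiff : ∀ s : ℕ, OrdLE (L ^ s - L' ^ s) (s - n) ∧
          (L ^ s - L' ^ s).coeff (s - n) = s • (L - L').coeff (1 - n) := by
        intro s
        induction s with
        | zero => exact ⟨by simpa using OrdLE.zero _, by simp⟩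
        | succ s ihs =>
          have e : L ^ (s + 1) - L' ^ (s + 1) = L ^ s * (L - L') + (L ^ s - L' ^ s) * L' := by
            rw [pow_succ, pow_succ, mul_sub, sub_mul]
            abel
          have a1 := (htop s).1.mul ih
          have a2 := ihs.1.mul h1'
          have e1 : (s : ℤ) + (1 - n) = ((s + 1 : ℕ) : ℤ) - n := by push_cast; ring
          have e2 : (s : ℤ) - n + 1 = ((s + 1 : ℕ) : ℤ) - n := by push_cast; ring
          have b1 := coeff_mul_top (htop s).1 ih
          have b2 := coeff_mul_top ihs.1 h1'
          rw [e1] at a1 b1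
          rw [e2] at a2 b2
          rw [e]
          refine ⟨a1.add a2, ?_⟩
          rw [coeff_add, b1, b2, (htop s).2, ihs.2, hc', one_mul, mul_one, succ_nsmul, add_comm]
      intro m hm
      rcases eq_or_lt_of_le (show 1 - (n : ℤ) ≤ m by push_cast at hm; omega) with h' | h'
      · rcases Nat.eq_zero_or_pos n with rfl | hn
        · rw [← h']
          simp [hc, hc']
        · have h2 := (hdiff n).2
          have h3 : (L ^ n - L' ^ n).coeff (n - n) = 0 := by
            have := congrArg (fun P => P.coeff 0) (h n hn)
            simpa [plus, sub_eq_zero] using this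
          rw [h3] at h2
          rw [← h']
          have h4 : ((n : ℚ)⁻¹ * (n : ℚ)) • (L - L').coeff (1 - n) = 0 := by
            rw [mul_smul, Nat.cast_smul_eq_nsmul, ← h2, smul_zero]
          rwa [inv_mul_cancel₀ (by positivity), one_smul] at h4
      · exact ih m h'
  rw [← sub_eq_zero]
  exact eq_zero_of_forall_ordLE fun N => (key (1 - N).toNat).mono (by omega)

end PDO

/-! ### Schur polynomials -/

namespace PowerSeries

variable {R : Type*} [Ring R]

/-- The Euler operator `∑ a_n z^n ↦ ∑ n a_n z^n`. -/
noncomputable def euler (f : PowerSeries R) : PowerSeries R := mk fun n => n • coeff n f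

theorem euler_mul (f g : PowerSeries R) : euler (f * g) = euler f * g + f * euler g := by
  ext n
  simp only [euler, coeff_mk, map_add, coeff_mul, Finset.smul_sum, ← Finset.sum_add_distrib]
  refine Finset.sum_congr rfl fun p hp => ?_
  rw [← mem_antidiagonal.1 hp, add_smul, smul_mul_assoc, mul_smul_comm]

theorem commute_of_coeff {f g : PowerSeries R} (h : ∀ i j, Commute (coeff i f) (coeff j g)) :
    Commute f g := by
  ext n
  rw [coeff_mul, coeff_mul, ← Finset.Nat.sum_antidiagonal_swap]
  exact Finset.sum_congr rfl fun p _ => (h _ _)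

theorem euler_pow {f : PowerSeries R} (h : Commute (euler f) f) (n : ℕ) :
    euler (f ^ (n + 1)) = (n + 1) • (euler f * f ^ n) := by
  induction n with
  | zero => simp
  | succ n ih =>
    rw [pow_succ, euler_mul, ih, smul_mul_assoc, mul_assoc, ← pow_succ, succ_nsmul _ (n + 1),
      (h.pow_right (n + 1)).eq]

theorem coeff_pow_eq_zero {f : PowerSeries R} (hf : coeff 0 f = 0) {n m : ℕ} (h : n < m) :
    coeff n (f ^ m) = 0 := by
  induction m generalizing n with
  | zero => omega
  | succ m ih =>
    rw [pow_succ, coeff_mul]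
    refine Finset.sum_eq_zero fun p hp => ?_
    have := mem_antidiagonal.1 hp
    rcases Nat.eq_zero_or_pos p.2 with h2 | h2
    · rw [h2, hf, mul_zero]
    · rw [ih (by omega), zero_mul]

end PowerSeries

section Schur

variable {k : Type*} [Field k]

theorem schur_zero {R : Type*} [Ring R] [Algebra k R] (y : ℕ → R) : schur k y 0 = 1 := by
  simp [schur]

theorem coeff_dressing_neg (d : ℕ → Derivation k (TimeFun k) (TimeFun k)) (τ : TimeFun k) (n : ℕ) :
    (dressing d τ).coeff (-n) = schurOp d n τ * τ⁻¹ := by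
  simp only [dressing]
  rw [if_neg (by omega), neg_neg, Int.toNat_natCast]

theorem schurOp_zero (d : ℕ → Derivation k (TimeFun k) (TimeFun k)) (f : TimeFun k) :
    schurOp d 0 f = f := by
  rw [schurOp, schur_zero]
  rfl

variable [CharZero k]

/-- The recursion `n p_n(y) = ∑_{l=1}^n l y_l p_{n-l}(y)`. -/
theorem schur_succ {R : Type*} [Ring R] [Algebra k R] (y : ℕ → R)
    (hy : ∀ i j, Commute (y i) (y j)) (n : ℕ) : (n + 1) • schur k y (n + 1) =
      ∑ p ∈ antidiagonal n, (p.1 + 1) • (y (p.1 + 1) * schur k y p.2) := by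
  set Y : PowerSeries R := PowerSeries.mk fun i => if i = 0 then 0 else y i with hY
  have hY0 : PowerSeries.coeff 0 Y = 0 := by simp [hY]
  -- The `y_i` are going to be differential operators, so the power rule for the Euler operator
  -- needs this commutation.
  have hcomm : Commute (PowerSeries.euler Y) Y := by
    refine PowerSeries.commute_of_coeff fun i j => ?_
    simp only [PowerSeries.euler, hY, PowerSeries.coeff_mk]
    refine Commute.smul_left ?_ i
    split_ifs
    · exact Commute.zero_left _
    · exact Commute.zero_left _
    · exact Commute.zero_right _
    · exact hy i j
  have hcoef : ∀ j, (n + 1) • PowerSeries.coeff (n + 1) (Y ^ (j + 1)) =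
      (j + 1) • ∑ p ∈ antidiagonal n,
        (p.1 + 1) • (y (p.1 + 1) * PowerSeries.coeff p.2 (Y ^ j)) := by
    intro j
    have := congrArg (PowerSeries.coeff (n + 1)) (PowerSeries.euler_pow hcomm j)
    rw [PowerSeries.euler, PowerSeries.coeff_mk] at this
    rw [this, map_nsmul, PowerSeries.coeff_mul, Finset.Nat.sum_antidiagonal_succ]
    simp [PowerSeries.euler, hY, mul_assoc]
  -- All the `p_b` with `b ≤ n` can be computed with one common truncation of the exponential
  -- series.
  have hsch : ∀ b ≤ n, schur k y b = ∑ j ∈ Finset.range (n + 1), ((j ! : k)⁻¹) •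
      PowerSeries.coeff b (Y ^ j) := by
    intro b hb
    refine Finset.sum_subset (fun j hj => ?_) (fun j _ hj => ?_)
    · rw [Finset.mem_range] at *; omega
    · rw [Finset.mem_range] at hj
      rw [PowerSeries.coeff_pow_eq_zero hY0 (by omega), smul_zero]
  rw [schur, Finset.sum_range_succ', pow_zero, PowerSeries.coeff_one, if_neg (by omega),
    smul_zero, add_zero, Finset.smul_sum]
  have h1 : ∀ j ∈ Finset.range (n + 1), (n + 1) • (((j + 1)! : k)⁻¹ •
      PowerSeries.coeff (n + 1) (Y ^ (j + 1))) = ∑ p ∈ antidiagonal n,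
        (p.1 + 1) • (y (p.1 + 1) * ((j ! : k)⁻¹ • PowerSeries.coeff p.2 (Y ^ j))) := by
    intro j _
    rw [smul_comm, hcoef, ← Nat.cast_smul_eq_nsmul k (j + 1), smul_smul, Finset.smul_sum]
    refine Finset.sum_congr rfl fun p _ => ?_
    rw [smul_comm, mul_smul_comm]
    congr 2
    have : ((j + 1 : ℕ) : k) ≠ 0 := Nat.cast_ne_zero.2 (Nat.succ_ne_zero j)
    have h2 : ((j ! : ℕ) : k) ≠ 0 := Nat.cast_ne_zero.2 (Nat.factorial_ne_zero j)
    rw [Nat.factorial_succ, Nat.cast_mul]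
    field_simp
  rw [Finset.sum_congr rfl h1, Finset.sum_comm]
  refine Finset.sum_congr rfl fun p hp => ?_
  have := mem_antidiagonal.1 hp
  rw [hsch p.2 (by omega), Finset.mul_sum, Finset.smul_sum]

/-- The recursion `n p_n(-[∂]) f = -∑_{l=1}^n ∂_l p_{n-l}(-[∂]) f`. -/
theorem schurOp_succ {d : ℕ → Derivation k (TimeFun k) (TimeFun k)}
    (hd : ∀ i j f, d i (d j f) = d j (d i f)) (n : ℕ) (f : TimeFun k) :
    (n + 1) • schurOp d (n + 1) f =
      -∑ p ∈ antidiagonal n, d (p.1 + 1) (schurOp d p.2 f) := by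
  have hy : ∀ i j : ℕ, Commute (-((i : k)⁻¹ • (d i : TimeFun k →ₗ[k] TimeFun k)))
      (-((j : k)⁻¹ • (d j : TimeFun k →ₗ[k] TimeFun k)) : Module.End k (TimeFun k)) := by
    intro i j
    have h : Commute (d i : Module.End k (TimeFun k)) (d j : Module.End k (TimeFun k)) := by
      ext1 f
      exact hd i j f
    exact (((h.smul_right _).smul_left _).neg_left).neg_right
  have h := congrArg (fun F : Module.End k (TimeFun k) => F f)
    (schur_succ (k := k) (fun i => -((i : k)⁻¹ • (d i : TimeFun k →ₗ[k] TimeFun k))) hy n)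
  simp only [LinearMap.smul_apply, LinearMap.sum_apply] at h
  rw [schurOp, h, ← Finset.sum_neg_distrib]
  refine Finset.sum_congr rfl fun p _ => ?_
  have h1 : ((p.1 + 1 : ℕ) : k) ≠ 0 := Nat.cast_ne_zero.2 (Nat.succ_ne_zero _)
  rw [← Nat.cast_smul_eq_nsmul k]
  simp only [Module.End.mul_apply, LinearMap.neg_apply, LinearMap.smul_apply, smul_neg, smul_smul,
    mul_inv_cancel₀ h1, one_smul]
  rfl

theorem nsmul_succ_left_injective {n : ℕ} {f g : TimeFun k} (h : (n + 1) • f = (n + 1) • g) :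
    f = g := by
  rw [← Nat.cast_smul_eq_nsmul k, ← Nat.cast_smul_eq_nsmul k] at h
  have h1 : ((n + 1 : ℕ) : k) ≠ 0 := Nat.cast_ne_zero.2 (Nat.succ_ne_zero n)
  have := congrArg (fun x => ((n + 1 : ℕ) : k)⁻¹ • x) h
  simpa only [smul_smul, inv_mul_cancel₀ h1, one_smul] using this

/-- `p_n(-[∂])` is linear over the constants of all the derivations. -/
theorem schurOp_const_mul {d : ℕ → Derivation k (TimeFun k) (TimeFun k)}
    (hd : ∀ i j f, d i (d j f) = d j (d i f)) {c : TimeFun k} (hc : ∀ l, 1 ≤ l → d l c = 0)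
    (n : ℕ) (f : TimeFun k) : schurOp d n (c * f) = c * schurOp d n f := by
  induction n using Nat.strong_induction_on with
  | _ n ih =>
    rcases n with _ | n
    · rw [schurOp_zero, schurOp_zero]
    · apply nsmul_succ_left_injective (n := n)
      rw [← mul_smul_comm, schurOp_succ hd, schurOp_succ hd, mul_neg, Finset.mul_sum]
      congr 1
      refine Finset.sum_congr rfl fun p hp => ?_
      have := mem_antidiagonal.1 hp
      rw [ih p.2 (by omega), Derivation.leibniz, hc _ (by omega), smul_zero, add_zero, smul_eq_mul]

end Schur

/-! ### Power series in several variables: closed forms and exponentials -/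

namespace MvPowerSeries

variable {σ k : Type*} [Field k]

theorem pderiv_comm (i j : σ) (f : MvPowerSeries σ k) :
    pderiv k i (pderiv k j f) = pderiv k j (pderiv k i f) := by
  classical
  ext n
  simp only [coeff_pderiv, Finsupp.add_apply, Finsupp.single_apply]
  rw [add_right_comm]
  rcases eq_or_ne i j with rfl | h
  · rfl
  · simp only [if_neg h, if_neg h.symm, add_zero]
    ring

theorem mul_inv_of_isUnit {f : MvPowerSeries σ k} (h : IsUnit f) : f * f⁻¹ = 1 :=
  MvPowerSeries.mul_inv_cancel f (isUnit_iff_ne_zero.1 (isUnit_iff_constantCoeff.1 h))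

/-- A closed one-form in the formal variables is exact. -/
theorem exists_pderiv_eq [CharZero k] (e : σ → MvPowerSeries σ k)
    (he : ∀ i j, pderiv k i (e j) = pderiv k j (e i)) :
    ∃ f : MvPowerSeries σ k, constantCoeff f = 0 ∧ ∀ i, pderiv k i f = e i := by
  classical
  have hc : ∀ (m : σ →₀ ℕ) (i j : σ), coeff (m + Finsupp.single j 1) (e i) *
      (((m + Finsupp.single j 1 + Finsupp.single i 1 : σ →₀ ℕ) j : ℕ) : k) =
      coeff (m + Finsupp.single i 1) (e j) *
        (((m + Finsupp.single j 1 + Finsupp.single i 1 : σ →₀ ℕ) i : ℕ) : k) := by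
    intro m i j
    have h := congrArg (coeff m) (he i j)
    rw [coeff_pderiv, coeff_pderiv] at h
    rcases eq_or_ne i j with rfl | hij
    · rfl
    · simp only [Finsupp.add_apply, Finsupp.single_apply, if_neg hij, if_neg hij.symm, if_true]
      push_cast
      simpa using h.symm
  -- Each coefficient is integrated along an arbitrarily chosen variable that occurs in the
  -- monomial. By `hc`, closedness in terms of coefficients, the choice does not matter.
  let f : MvPowerSeries σ k := fun m => if h : m = 0 then 0 else
    coeff (m - Finsupp.single (Finsupp.ne_iff.1 h).choose 1) (e (Finsupp.ne_iff.1 h).choose) *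
      (m (Finsupp.ne_iff.1 h).choose : k)⁻¹
  have hf : ∀ m, coeff m f = f m := fun m => rfl
  refine ⟨f, ?_, fun i => ?_⟩
  · rw [← coeff_zero_eq_constantCoeff_apply, hf]
    exact dif_pos rfl
  · ext m
    have hm : m + Finsupp.single i 1 ≠ 0 := by
      intro h
      have := DFunLike.congr_fun h i
      simp at this
    rw [coeff_pderiv, hf]
    simp only [f]
    rw [dif_neg hm]
    set j := (Finsupp.ne_iff.1 hm).choose with hj
    have hj0 : (m + Finsupp.single i 1 : σ →₀ ℕ) j ≠ 0 := (Finsupp.ne_iff.1 hm).choose_spec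
    have hj0' : (((m + Finsupp.single i 1 : σ →₀ ℕ) j : ℕ) : k) ≠ 0 := Nat.cast_ne_zero.2 hj0
    have hi : ((m i : k) + 1) = (((m + Finsupp.single i 1 : σ →₀ ℕ) i : ℕ) : k) := by simp
    rw [hi]
    clear hi hj
    clear_value j
    rcases eq_or_ne j i with h | h
    · rw [h] at hj0' ⊢
      rw [add_tsub_cancel_right, inv_mul_cancel_right₀ hj0']
    · have hmj : m j ≠ 0 := by simpa [Finsupp.single_apply, h.symm] using hj0
      obtain ⟨m', rfl⟩ : ∃ m', m = m' + Finsupp.single j 1 := by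
        refine ⟨m - Finsupp.single j 1, (tsub_add_cancel_of_le ?_).symm⟩
        rw [Finsupp.single_le_iff]
        omega
      have hsub : m' + Finsupp.single j 1 + Finsupp.single i 1 - Finsupp.single j 1 =
          m' + Finsupp.single i 1 := by
        rw [add_right_comm, add_tsub_cancel_right]
      have h3 := hc m' i j
      rw [hsub, mul_assoc, mul_comm _⁻¹, ← mul_assoc, ← h3, mul_inv_cancel_right₀ hj0']

theorem coeff_pow_eq_zero {f : MvPowerSeries σ k} (hf : constantCoeff f = 0) {n : ℕ} {m : σ →₀ ℕ}
    (h : m.degree < n) : coeff m (f ^ n) = 0 := by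
  classical
  induction n generalizing m with
  | zero => omega
  | succ n ih =>
    rw [pow_succ, coeff_mul]
    refine Finset.sum_eq_zero fun p hp => ?_
    rw [← mem_antidiagonal.1 hp, map_add] at h
    rcases Nat.eq_zero_or_pos p.2.degree with h2 | h2
    · rw [Finsupp.degree_eq_zero_iff] at h2
      rw [h2, coeff_zero_eq_constantCoeff_apply, hf, mul_zero]
    · rw [ih (by omega), zero_mul]

/-- For a closed one-form `e` the system `∂_i c = e_i c` has an invertible solution. -/
theorem exists_unit_pderiv_eq [CharZero k] (e : σ → MvPowerSeries σ k)
    (he : ∀ i j, pderiv k i (e j) = pderiv k j (e i)) :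
    ∃ c : MvPowerSeries σ k, IsUnit c ∧ ∀ i, pderiv k i c = e i * c := by
  classical
  obtain ⟨f, hf, hfe⟩ := exists_pderiv_eq e he
  -- This is `exp f`: since `f` has no constant term, `f^n` only contributes in degree at least `n`,
  -- and every coefficient is a finite sum even with infinitely many variables.
  let c : MvPowerSeries σ k := fun m =>
    ∑ n ∈ Finset.range (m.degree + 1), (n ! : k)⁻¹ * coeff m (f ^ n)
  have hc : ∀ (m : σ →₀ ℕ) (N : ℕ), m.degree < N →
      coeff m c = ∑ n ∈ Finset.range N, (n ! : k)⁻¹ * coeff m (f ^ n) := by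
    intro m N hN
    change ∑ n ∈ Finset.range (m.degree + 1), (n ! : k)⁻¹ * coeff m (f ^ n) = _
    refine Finset.sum_subset (fun j hj => ?_) (fun j _ hj => ?_)
    · rw [Finset.mem_range] at *; omega
    · rw [Finset.mem_range] at hj
      rw [coeff_pow_eq_zero hf (by omega), mul_zero]
  refine ⟨c, ?_, fun i => ?_⟩
  · rw [isUnit_iff_constantCoeff, ← coeff_zero_eq_constantCoeff_apply, hc 0 1 (by simp)]
    simp
  · ext m
    rw [coeff_pderiv, hc _ (m.degree + 2) (by simp), coeff_mul, Finset.sum_range_succ', pow_zero,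
      coeff_one, if_neg (fun h => by simpa using DFunLike.congr_fun h i), mul_zero, add_zero,
      Finset.sum_mul]
    have h1 : ∀ p ∈ antidiagonal m, coeff p.1 (e i) * coeff p.2 c =
        ∑ n ∈ Finset.range (m.degree + 1), (n ! : k)⁻¹ * (coeff p.1 (e i) * coeff p.2 (f ^ n)) := by
      intro p hp
      rw [hc p.2 (m.degree + 1), Finset.mul_sum]
      · exact Finset.sum_congr rfl fun n _ => by ring
      · rw [← mem_antidiagonal.1 hp, map_add]
        omega
    rw [Finset.sum_congr rfl h1, Finset.sum_comm]
    refine Finset.sum_congr rfl fun n _ => ?_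
    rw [← Finset.mul_sum, ← coeff_mul, mul_assoc, ← coeff_pderiv, Derivation.leibniz_pow,
      Nat.add_sub_cancel, hfe, smul_eq_mul, mul_comm (f ^ n), map_nsmul, nsmul_eq_mul, ← mul_assoc]
    congr 1
    have : ((n + 1 : ℕ) : k) ≠ 0 := Nat.cast_ne_zero.2 (Nat.succ_ne_zero n)
    have h2 : ((n ! : ℕ) : k) ≠ 0 := Nat.cast_ne_zero.2 (Nat.factorial_ne_zero n)
    rw [Nat.factorial_succ, Nat.cast_mul]
    field_simp

end MvPowerSeries

/-! ### Residue pairing of symbols -/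

namespace PDO

variable {k A : Type*} [Field k] [CommRing A] [Algebra k A] {δ : Derivation k A A}

/-- The symbol `∑ a_{-n} ζ^n` of an operator `∑ a_{-n} D^{-n}` of order at most `0`. -/
noncomputable def symbol (P : PDO δ) : PowerSeries A := PowerSeries.mk fun n => P.coeff (-n)

/-- The series `∑ Res(D^(n-1) Q) ζ^n`. -/
noncomputable def cosymbol (Q : PDO δ) : PowerSeries A :=
  PowerSeries.mk fun n => (D δ (n - 1) * Q).res

theorem ordLE_sub_trunc {P : PDO δ} (hP : OrdLE P 0) (n : ℕ) :
    OrdLE (P - ∑ i ∈ Finset.range n, monomial δ (-i) (P.coeff (-i))) (-n) := by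
  intro m hm
  rw [coeff_sub, coeff_sum]
  simp only [coeff_monomial]
  rcases lt_or_ge 0 m with h | h
  · rw [hP m h, Finset.sum_eq_zero fun i _ => if_neg (by omega), sub_zero]
  · rw [Finset.sum_eq_single (-m).toNat]
    · rw [if_pos (by omega), show (-((-m).toNat : ℤ)) = m by omega, sub_self]
    · intro i _ hi
      rw [if_neg (by omega)]
    · intro hi
      exact absurd (Finset.mem_range.2 (by omega)) hi

/-- Writing `P = ∑ a_{-i} D^{-i}` with coefficients on the left, the residue of `P D^l Q` is the sum
of `a_{-i} Res(D^{l-i} Q)`; terms with `i ≥ l + 2` have order at most `-2`. Residues of operator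
products thereby become coefficients in a commutative power series ring, where a common factor can
be eliminated. -/
theorem coeff_symbol_mul_cosymbol {P Q : PDO δ} (hP : OrdLE P 0) (hQ : OrdLE Q 0) (l : ℕ) :
    PowerSeries.coeff (l + 1) (symbol P * cosymbol Q) = (P * (D δ l * Q)).res := by
  have h1 : ((P - ∑ i ∈ Finset.range (l + 2), monomial δ (-i) (P.coeff (-i))) *
      (D δ l * Q)).res = 0 :=
    OrdLE.res_eq_zero <| ((ordLE_sub_trunc hP (l + 2)).mul ((ordLE_D l).mul hQ)).mono
      (by push_cast; omega)
  rw [sub_mul, res_sub, sub_eq_zero] at h1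
  rw [h1, PowerSeries.coeff_mul, Finset.Nat.sum_antidiagonal_eq_sum_range_succ_mk, Finset.sum_mul,
    res, coeff_sum]
  refine Finset.sum_congr rfl fun i hi => ?_
  have hi' := Finset.mem_range.1 hi
  rw [symbol, cosymbol, PowerSeries.coeff_mk, PowerSeries.coeff_mk, monomial_eq, mul_assoc,
    coeff_C_mul, ← mul_assoc, D_mul_D, res]
  congr 4
  push_cast [show i ≤ l + 1 by omega]
  ring

theorem coeff_zero_symbol_mul_cosymbol (P Q : PDO δ) :
    PowerSeries.coeff 0 (symbol P * cosymbol Q) = P.coeff 0 * (D δ (-1) * Q).res := by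
  simp [PowerSeries.coeff_mul, symbol, cosymbol]

theorem symbol_mul_cosymbol {P Q : PDO δ} (hP : OrdLE P 0) (hQ : OrdLE Q 0) :
    symbol P * cosymbol Q = PowerSeries.C (P.coeff 0 * (D δ (-1) * Q).res) +
      PowerSeries.X * PowerSeries.mk fun l => (P * (D δ l * Q)).res := by
  ext n
  rcases n with _ | n
  · rw [coeff_zero_symbol_mul_cosymbol]
    simp
  · rw [coeff_symbol_mul_cosymbol hP hQ]
    simp [PowerSeries.coeff_succ_X_mul]

end PDO

/-! ### The tau-function and squared eigenfunction potentials -/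

section SquaredEigenfunction

open PDO

variable {k : Type*} [Field k] {d : ℕ → Derivation k (TimeFun k) (TimeFun k)}
  {L : PDO (d 1)} {τ Φ Ψ S : TimeFun k}

theorem coeff_dressing_zero (hτ : IsUnit τ) : (dressing d τ).coeff 0 = 1 := by
  have := coeff_dressing_neg d τ 0
  rw [Nat.cast_zero, neg_zero] at this
  rw [this, schurOp_zero, MvPowerSeries.mul_inv_of_isUnit hτ]

theorem ordLE_dressing_sub_one (hτ : IsUnit τ) : OrdLE (dressing d τ - 1) (-1) := by
  intro n hn
  rw [coeff_sub, coeff_one]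
  split_ifs with h
  · rw [h, coeff_dressing_zero hτ, sub_self]
  · rw [sub_zero]
    exact if_pos (by omega)

variable [CharZero k]

/-- The recursion for the coefficients of the dressing operator. -/
theorem dressing_coeff_recursion (hd : ∀ i j f, d i (d j f) = d j (d i f)) (hτ : IsUnit τ)
    (n : ℕ) : (n + 1) • (dressing d τ).coeff (-(n + 1 : ℕ)) +
      ∑ p ∈ antidiagonal n, (d (p.1 + 1) ((dressing d τ).coeff (-p.2)) +
        dlog (d (p.1 + 1)) τ * (dressing d τ).coeff (-p.2)) = 0 := by
  have hτ' := MvPowerSeries.mul_inv_of_isUnit hτ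
  simp only [coeff_dressing_neg, dlog]
  rw [← smul_mul_assoc, schurOp_succ hd, neg_mul, Finset.sum_mul, neg_add_eq_zero]
  refine Finset.sum_congr rfl fun p _ => ?_
  have h1 : d (p.1 + 1) (schurOp d p.2 τ) =
      d (p.1 + 1) (τ * (schurOp d p.2 τ * τ⁻¹)) := by
    rw [mul_left_comm, hτ', mul_one]
  rw [h1, Derivation.leibniz, smul_eq_mul, smul_eq_mul]
  linear_combination (d (p.1 + 1) (schurOp d p.2 τ * τ⁻¹)) * hτ'

/-- The coefficients `χ_n` of `D⁻¹ Ψ W` satisfy the recursion of `p_{n-1}(-[∂])(τ Ψ) / τ`. -/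
theorem adjoint_darboux_recursion (hd : ∀ i j f, d i (d j f) = d j (d i f))
    (hτ : IsTauFunction d L τ) (hΨ : IsAdjointEigenfunction d L Ψ) (n : ℕ) :
    n • (D (d 1) (-1) * (C (d 1) Ψ * dressing d τ)).coeff (-(n + 1 : ℕ)) +
      ∑ p ∈ antidiagonal n,
        (d (p.1 + 1) ((D (d 1) (-1) * (C (d 1) Ψ * dressing d τ)).coeff (-p.2)) +
        dlog (d (p.1 + 1)) τ * (D (d 1) (-1) * (C (d 1) Ψ * dressing d τ)).coeff (-p.2)) = 0 := by
  have hW1 := ordLE_dressing_sub_one (d := d) hτ.isUnit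
  have hw0 := coeff_dressing_zero (d := d) hτ.isUnit
  have hR := dressing_coeff_recursion hd hτ.isUnit
  set W := dressing d τ with hW
  have hW0 := ordLE_zero_of_sub_one hW1
  obtain ⟨U, hWU, hUW, hU1⟩ := exists_inverse hW1
  have hU0 := ordLE_zero_of_sub_one hU1
  have hpow := fun l => pow_dressed hWU hτ.dress l
  set V := D (d 1) (-1) * (C (d 1) Ψ * W) with hV
  have hVord : OrdLE V (-1) := ((ordLE_D (-1)).mul ((ordLE_C Ψ).mul hW0))
  have hV0 : OrdLE V 0 := hVord.mono (by omega)
  have hχ0 : V.coeff 0 = 0 := hVord 0 (by omega)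
  have hDV : ∀ n : ℕ, d 1 (V.coeff (-n)) + V.coeff (-(n + 1 : ℕ)) = Ψ * W.coeff (-n) := by
    intro n
    have := congrArg (fun P => P.coeff (-n : ℤ)) (D_one_mul_D_neg_one_mul (C (d 1) Ψ * W))
    simp only [coeff_D_one_mul, coeff_C_mul] at this
    rw [← hV] at this
    rw [← this]
    congr 2
    push_cast
    ring
  set ψ : ℕ → TimeFun k := fun l => (D (d 1) (-1) * (C (d 1) Ψ * L ^ l)).res with hψ
  have hψ0 : ψ 0 = Ψ := by
    have := coeff_mul_top (ordLE_D (δ := d 1) (-1)) ((ordLE_C Ψ))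
    simp only [hψ, pow_zero, mul_one]
    rw [add_zero] at this
    rw [res, this]
    simp [D, C, coeff_monomial]
  have hψl : ∀ l, d (l + 1) Ψ = -ψ (l + 1) := by
    intro l
    rw [hΨ (l + 1) (by omega), pow_eq, ← adjoint_pow, applyPlus_adjoint]
  set ρ : ℕ → TimeFun k := fun l => (L ^ l).res with hρ
  have hρ0 : ρ 0 = 0 := by simp [hρ, res, coeff_one]
  have hρl : ∀ l, d 1 (dlog (d (l + 1)) τ) = ρ (l + 1) := by
    intro l
    rw [hτ.res (l + 1) (by omega), pow_eq]
  -- Since `U = W⁻¹`, one has `V D^l U = D⁻¹ Ψ L^l`, whose residue is `-∂_{t_l} Ψ` for `l ≥ 1`;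
  -- pairing `W` with `U` in the same way produces `Res L^l`.
  have hvu : symbol V * cosymbol U = PowerSeries.X * PowerSeries.mk ψ := by
    rw [symbol_mul_cosymbol hV0 hU0, hχ0, zero_mul, map_zero, zero_add]
    congr 2
    funext l
    simp only [hψ, hpow, hV, mul_assoc]
  have hwu : symbol W * cosymbol U = 1 + PowerSeries.X * PowerSeries.mk ρ := by
    have h1 : (D (d 1) (-1) * U).res = 1 := by
      have := coeff_mul_top (ordLE_D (δ := d 1) (-1)) hU0
      rw [add_zero] at this
      rw [res, this]
      have hu := hU1 0 (by omega)
      rw [coeff_sub, coeff_one, if_pos rfl, sub_eq_zero] at hu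
      simp [D, coeff_monomial, hu]
    rw [symbol_mul_cosymbol hW0 hU0, hw0, h1, one_mul, map_one]
    congr 3
    funext l
    simp only [hρ, hpow, mul_assoc]
  -- The cosymbol of `U` is eliminated between the two pairings.
  have hN : symbol V = PowerSeries.X *
      (PowerSeries.mk ψ * symbol W - PowerSeries.mk ρ * symbol V) := by
    linear_combination (symbol W) * hvu - symbol V * hwu
  have hχ : ∀ n : ℕ, V.coeff (-(n + 1 : ℕ)) =
      ∑ p ∈ antidiagonal n, (ψ p.1 * W.coeff (-p.2) - ρ p.1 * V.coeff (-p.2)) := by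
    intro n
    have := congrArg (PowerSeries.coeff (n + 1)) hN
    rw [PowerSeries.coeff_succ_X_mul, map_sub, PowerSeries.coeff_mul, PowerSeries.coeff_mul,
      ← Finset.sum_sub_distrib] at this
    simpa only [symbol, PowerSeries.coeff_mk] using this
  induction n with
  | zero => simp [hχ0]
  | succ n ih =>
    -- The case `n` is differentiated along `x`; substituting `∂χ_b = Ψ w_b - χ_{b+1}` from `D V = Ψ
    -- W` raises the index to `n + 1`, and `hχ` accounts for the derivatives of `Ψ` and of `∂_{t_l}
    -- ln τ`.
    have h1 := congrArg (d 1) ih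
    rw [map_zero, map_add, map_nsmul, map_sum] at h1
    have h2 := hχ (n + 1)
    rw [Finset.Nat.sum_antidiagonal_succ, hψ0, hρ0, zero_mul, sub_zero] at h2
    rw [Finset.Nat.sum_antidiagonal_succ']
    simp only [Nat.cast_zero, neg_zero, hχ0, map_zero, mul_zero, add_zero]
    have h3 : ∑ p ∈ antidiagonal n, d 1 (d (p.1 + 1) (V.coeff (-p.2)) +
          dlog (d (p.1 + 1)) τ * V.coeff (-p.2)) +
        ∑ p ∈ antidiagonal n, (d (p.1 + 1) (V.coeff (-(p.2 + 1 : ℕ))) +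
          dlog (d (p.1 + 1)) τ * V.coeff (-(p.2 + 1 : ℕ))) =
        Ψ * ∑ p ∈ antidiagonal n, (d (p.1 + 1) (W.coeff (-p.2)) +
          dlog (d (p.1 + 1)) τ * W.coeff (-p.2)) -
        ∑ p ∈ antidiagonal n,
          (ψ (p.1 + 1) * W.coeff (-p.2) - ρ (p.1 + 1) * V.coeff (-p.2)) := by
      rw [Finset.mul_sum, ← Finset.sum_add_distrib, ← Finset.sum_sub_distrib]
      refine Finset.sum_congr rfl fun p _ => ?_
      have e1 := hDV p.2
      have e2 := congrArg (d (p.1 + 1)) e1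
      rw [map_add, Derivation.leibniz, hψl, hd] at e2
      rw [map_add, Derivation.leibniz, hρl]
      simp only [smul_eq_mul] at e2 ⊢
      linear_combination e2 + dlog (d (p.1 + 1)) τ * e1
    have h4 := hR n
    have h5 := hDV (n + 1)
    simp only [nsmul_eq_mul, Nat.cast_add, Nat.cast_one] at h1 h2 h3 h4 h5 ⊢
    linear_combination h3 - h1 + n * h5 + h2 + Ψ * h4

/-- The recursion for the coefficients of `Φ D⁻¹ Ψ W`, in terms of the squared eigenfunction
potential. -/
theorem squared_eigenfunction_recursion (hd : ∀ i j f, d i (d j f) = d j (d i f))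
    (hτ : IsTauFunction d L τ) (hΦ : IsEigenfunction d L Φ) (hΨ : IsAdjointEigenfunction d L Ψ)
    (hS : IsSEP d L Φ Ψ S) (n : ℕ) :
    (n + 1) • (C (d 1) Φ * (D (d 1) (-1) * C (d 1) Ψ) * dressing d τ).coeff (-(n + 1 : ℕ)) +
      ∑ p ∈ antidiagonal n,
        (d (p.1 + 1) ((C (d 1) Φ * (D (d 1) (-1) * C (d 1) Ψ) * dressing d τ).coeff (-p.2)) +
        dlog (d (p.1 + 1)) τ *
          (C (d 1) Φ * (D (d 1) (-1) * C (d 1) Ψ) * dressing d τ).coeff (-p.2)) =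
      ∑ p ∈ antidiagonal n, d (p.1 + 1) S * (dressing d τ).coeff (-p.2) := by
  have hW1 := ordLE_dressing_sub_one (d := d) hτ.isUnit
  have hX := adjoint_darboux_recursion hd hτ hΨ n
  simp only [mul_assoc, coeff_C_mul]
  set W := dressing d τ with hW
  have hW0 := ordLE_zero_of_sub_one hW1
  obtain ⟨U, hWU, hUW, hU1⟩ := exists_inverse hW1
  have hU0 := ordLE_zero_of_sub_one hU1
  have hpow := fun l => pow_dressed hWU hτ.dress l
  set V := D (d 1) (-1) * (C (d 1) Ψ * W) with hV
  have hVord : OrdLE V (-1) := ((ordLE_D (-1)).mul ((ordLE_C Ψ).mul hW0))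
  have hV0 : OrdLE V 0 := hVord.mono (by omega)
  have hχ0 : V.coeff 0 = 0 := hVord 0 (by omega)
  set U' := U * (C (d 1) Φ * D (d 1) (-1)) with hU'
  have hU'ord : OrdLE U' (-1) := hU0.mul ((ordLE_C Φ).mul (ordLE_D (-1)))
  have hU'0 : OrdLE U' 0 := hU'ord.mono (by omega)
  set η : ℕ → TimeFun k := fun l => (L ^ l * (C (d 1) Φ * D (d 1) (-1))).res with hη
  have hη0 : η 0 = Φ := by simp [hη, res, coeff_C_mul, D, coeff_monomial]
  have hηl : ∀ l, d (l + 1) Φ = η (l + 1) := by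
    intro l
    rw [hΦ (l + 1) (by omega), pow_eq, applyPlus_eq_res]
  set σ : ℕ → TimeFun k := fun l =>
    (D (d 1) (-1) * (C (d 1) Ψ * (L ^ l * (C (d 1) Φ * D (d 1) (-1))))).res with hσ
  have hσ0 : σ 0 = 0 := by
    simp only [hσ, pow_zero, one_mul]
    exact ((ordLE_D (-1)).mul ((ordLE_C Ψ).mul ((ordLE_C Φ).mul (ordLE_D (-1))))).res_eq_zero
  have hσl : ∀ l, d (l + 1) S = σ (l + 1) := by
    intro l
    rw [hS (l + 1) (by omega), pow_eq]
    -- The negative part of `L^l` contributes order at most `-3`, so `L^l` can replace `(L^l)_+` in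
    -- the definition of the potential.
    have h1 : (D (d 1) (-1) * (C (d 1) Ψ * ((L ^ (l + 1)).minus *
        (C (d 1) Φ * D (d 1) (-1))))).res = 0 :=
      OrdLE.res_eq_zero <| ((ordLE_D (-1)).mul ((ordLE_C Ψ).mul ((ordLE_minus _).mul
        ((ordLE_C Φ).mul (ordLE_D (-1)))))).mono (by omega)
    simp only [hσ]
    conv_rhs => rw [← plus_add_minus (L ^ (l + 1)), add_mul, mul_add, mul_add, res_add, h1, add_zero]
  have hwu : symbol W * cosymbol U' = PowerSeries.X * PowerSeries.mk η := by
    have h1 : (D (d 1) (-1) * U').res = 0 := ((ordLE_D (-1)).mul hU'ord).res_eq_zero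
    rw [symbol_mul_cosymbol hW0 hU'0, h1, mul_zero, map_zero, zero_add]
    congr 2
    funext l
    simp only [hη, hpow, hU', mul_assoc]
  have hvu : symbol V * cosymbol U' = PowerSeries.X * PowerSeries.mk σ := by
    rw [symbol_mul_cosymbol hV0 hU'0, hχ0, zero_mul, map_zero, zero_add]
    congr 2
    funext l
    simp only [hσ, hpow, hU', hV, mul_assoc]
  -- Pairing `W` and `V` with the same `U' = W⁻¹ Φ D⁻¹` produces `∂_{t_l} Φ` and `∂_{t_l} S`;
  -- eliminating its cosymbol relates the two series.
  have hK : PowerSeries.X * (PowerSeries.mk η * symbol V) =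
      PowerSeries.X * (PowerSeries.mk σ * symbol W) := by
    linear_combination symbol W * hvu - symbol V * hwu
  have hK' := congrArg (PowerSeries.coeff (n + 2)) hK
  rw [PowerSeries.coeff_succ_X_mul, PowerSeries.coeff_succ_X_mul, PowerSeries.coeff_mul,
    PowerSeries.coeff_mul, Finset.Nat.sum_antidiagonal_succ, Finset.Nat.sum_antidiagonal_succ] at hK'
  simp only [symbol, PowerSeries.coeff_mk, hη0, hσ0, zero_mul, zero_add] at hK'
  have h3 : ∑ p ∈ antidiagonal n, (d (p.1 + 1) (Φ * V.coeff (-p.2)) +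
        dlog (d (p.1 + 1)) τ * (Φ * V.coeff (-p.2))) =
      Φ * ∑ p ∈ antidiagonal n, (d (p.1 + 1) (V.coeff (-p.2)) +
        dlog (d (p.1 + 1)) τ * V.coeff (-p.2)) +
      ∑ p ∈ antidiagonal n, η (p.1 + 1) * V.coeff (-p.2) := by
    rw [Finset.mul_sum, ← Finset.sum_add_distrib]
    refine Finset.sum_congr rfl fun p _ => ?_
    rw [Derivation.leibniz, hηl]
    simp only [smul_eq_mul]
    ring
  have h4 : ∑ p ∈ antidiagonal n, d (p.1 + 1) S * W.coeff (-p.2) =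
      ∑ p ∈ antidiagonal n, σ (p.1 + 1) * W.coeff (-p.2) :=
    Finset.sum_congr rfl fun p _ => by rw [hσl]
  rw [h3, h4, ← hK']
  simp only [nsmul_eq_mul, Nat.cast_add, Nat.cast_one] at hX ⊢
  linear_combination Φ * hX

/-- If an additional flow acts on the dressing operator by `∑ Φ_j D⁻¹ Ψ_j`, then it acts on
`∂_{t_l} ln τ` by `-∂_{t_l} ∑ S(Φ_j, Ψ_j)`. -/
theorem deriv_dlog_of_flow {ι : Type*} (s : Finset ι) {F G P : ι → TimeFun k}
    (db : Derivation k (TimeFun k) (TimeFun k)) (hd : ∀ i j f, d i (d j f) = d j (d i f))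
    (hdb : ∀ i f, db (d i f) = d i (db f))
    (hτ : IsTauFunction d L τ) (hF : ∀ i ∈ s, IsEigenfunction d L (F i))
    (hG : ∀ i ∈ s, IsAdjointEigenfunction d L (G i)) (hP : ∀ i ∈ s, IsSEP d L (F i) (G i) (P i))
    (hflow : PDO.deriv db (dressing d τ) =
      (∑ i ∈ s, C (d 1) (F i) * (D (d 1) (-1) * C (d 1) (G i))) * dressing d τ) (l : ℕ) :
    db (dlog (d (l + 1)) τ) = -d (l + 1) (∑ i ∈ s, P i) := by
  have hw0 := coeff_dressing_zero (d := d) hτ.isUnit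
  have hv : ∀ n : ℤ, db ((dressing d τ).coeff n) = ∑ i ∈ s,
      (C (d 1) (F i) * (D (d 1) (-1) * C (d 1) (G i)) * dressing d τ).coeff n := by
    intro n
    rw [← coeff_deriv, hflow, Finset.sum_mul, coeff_sum]
  -- The recursion for the coefficients of `W`, differentiated along the extra flow, is compared
  -- with the recursion satisfied by their derivatives, which are coefficients of `∑ Φ_j D⁻¹ Ψ_j W`.
  have key : ∀ n : ℕ, ∑ p ∈ antidiagonal n, (db (dlog (d (p.1 + 1)) τ) +
      d (p.1 + 1) (∑ i ∈ s, P i)) * (dressing d τ).coeff (-p.2) = 0 := by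
    intro n
    have h1 := congrArg db (dressing_coeff_recursion hd hτ.isUnit n)
    have h2 := Finset.sum_congr (rfl : s = s) fun i hi =>
      squared_eigenfunction_recursion hd hτ (hF i hi) (hG i hi) (hP i hi) n
    rw [map_zero, map_add, map_nsmul, map_sum, hv] at h1
    rw [Finset.sum_add_distrib, ← Finset.smul_sum, Finset.sum_comm,
      Finset.sum_comm (s := s) (t := antidiagonal n)] at h2
    rw [← eq_sub_iff_add_eq'] at h2
    have h3 : ∀ p ∈ antidiagonal n, (db (dlog (d (p.1 + 1)) τ) +
        d (p.1 + 1) (∑ i ∈ s, P i)) * (dressing d τ).coeff (-p.2) =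
        db (d (p.1 + 1) ((dressing d τ).coeff (-p.2)) +
          dlog (d (p.1 + 1)) τ * (dressing d τ).coeff (-p.2)) -
        (∑ i ∈ s, (d (p.1 + 1)
          ((C (d 1) (F i) * (D (d 1) (-1) * C (d 1) (G i)) * dressing d τ).coeff (-p.2)) +
        dlog (d (p.1 + 1)) τ *
          (C (d 1) (F i) * (D (d 1) (-1) * C (d 1) (G i)) * dressing d τ).coeff (-p.2))) +
        ∑ i ∈ s, d (p.1 + 1) (P i) * (dressing d τ).coeff (-p.2) := by
      intro p _
      rw [map_add, hdb, Derivation.leibniz, hv, Finset.sum_add_distrib, ← Finset.mul_sum,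
        ← Finset.sum_mul, ← map_sum, ← map_sum]
      simp only [smul_eq_mul]
      ring
    rw [Finset.sum_congr rfl h3, Finset.sum_add_distrib, Finset.sum_sub_distrib, h2]
    linear_combination h1
  -- The system `key` is triangular with diagonal entries `w_0 = 1`.
  have main : ∀ l : ℕ, db (dlog (d (l + 1)) τ) + d (l + 1) (∑ i ∈ s, P i) = 0 := by
    intro l
    induction l using Nat.strong_induction_on with
    | _ l ih =>
      have h := key l
      rw [Finset.sum_eq_single (l, 0)] at h
      · simpa [hw0] using h
      · intro p hp hne
        have := mem_antidiagonal.1 hp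
        rw [ih p.1, zero_mul]
        by_contra hlt
        apply hne
        ext <;> simp only <;> omega
      · intro hn
        exact absurd (mem_antidiagonal.2 (add_zero l)) hn
  exact eq_neg_of_add_eq_zero_left (main l)

end SquaredEigenfunction

/-! ### Sums over antidiagonals -/

section Antidiagonal

variable {M : Type*} [AddCommMonoid M]

theorem sum_Icc_eq_sum_antidiagonal (n : ℕ) (g : ℕ → ℕ → M) :
    ∑ j ∈ Finset.Icc 1 (n + 1), g (n + 1 - j + 1) j =
      ∑ p ∈ antidiagonal n, g (p.1 + 1) (p.2 + 1) := by
  refine Finset.sum_nbij' (fun j => (n + 1 - j, j - 1)) (fun p => p.2 + 1) ?_ ?_ ?_ ?_ ?_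
  · intro j hj
    rw [Finset.mem_Icc] at hj
    rw [mem_antidiagonal]
    omega
  · intro p hp
    rw [mem_antidiagonal] at hp
    rw [Finset.mem_Icc]
    omega
  · intro j hj
    rw [Finset.mem_Icc] at hj
    simp only
    omega
  · intro p hp
    rw [mem_antidiagonal] at hp
    ext <;> omega
  · intro j hj
    rw [Finset.mem_Icc] at hj
    rw [Nat.sub_add_cancel hj.1]

/-- A sum over `a + b = r + s`, split according to the value of `a`. -/
theorem sum_antidiagonal_split (r s : ℕ) (g : ℕ → ℕ → M) :
    ∑ p ∈ antidiagonal s, g (p.1 + 1) (p.2 + 1 + (r + 1)) +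
      ∑ p ∈ antidiagonal r, g (p.1 + 1 + (s + 1)) (p.2 + 1) =
    ∑ p ∈ antidiagonal (r + s + 1), g (p.1 + 1) (p.2 + 1) := by
  simp only [Finset.Nat.sum_antidiagonal_eq_sum_range_succ_mk]
  rw [show (r + s + 1).succ = (s + 1) + (r + 1) by omega, Finset.sum_range_add]
  congr 1
  · refine Finset.sum_congr rfl fun a ha => ?_
    have := Finset.mem_range.1 ha
    congr 1
    omega
  · refine Finset.sum_congr rfl fun a ha => ?_
    have := Finset.mem_range.1 ha
    congr 1 <;> omega

end Antidiagonal

/-- The difference of shifted sums is symmetric in the two shifts. -/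
theorem sum_antidiagonal_shift_comm {M : Type*} [AddCommGroup M] (r s : ℕ) (g : ℕ → ℕ → M) :
    ∑ p ∈ antidiagonal s, g (p.1 + 1) (p.2 + 1 + (r + 1)) -
      ∑ p ∈ antidiagonal s, g (p.1 + 1 + (r + 1)) (p.2 + 1) =
    ∑ p ∈ antidiagonal r, g (p.1 + 1) (p.2 + 1 + (s + 1)) -
      ∑ p ∈ antidiagonal r, g (p.1 + 1 + (s + 1)) (p.2 + 1) := by
  rw [sub_eq_sub_iff_add_eq_add, sum_antidiagonal_split, sum_antidiagonal_split, add_comm r s]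

/-! ### Logarithmic derivatives -/

section Dlog

variable {k : Type*} [Field k] {d d' : Derivation k (TimeFun k) (TimeFun k)} {f g : TimeFun k}

theorem dlog_mul_self (hf : IsUnit f) : dlog d f * f = d f := by
  rw [dlog, mul_assoc, mul_comm _ f, MvPowerSeries.mul_inv_of_isUnit hf, mul_one]

theorem dlog_eq_of_mul_eq (hf : IsUnit f) (h : d f = g * f) : dlog d f = g := by
  rw [dlog, h, mul_assoc, MvPowerSeries.mul_inv_of_isUnit hf, mul_one]

theorem dlog_mul (hf : IsUnit f) (hg : IsUnit g) : dlog d (f * g) = dlog d f + dlog d g := by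
  apply dlog_eq_of_mul_eq (hf.mul hg)
  rw [Derivation.leibniz, ← dlog_mul_self hf, ← dlog_mul_self hg, smul_eq_mul, smul_eq_mul]
  ring

theorem isUnit_inv (hf : IsUnit f) : IsUnit f⁻¹ :=
  IsUnit.of_mul_eq_one f (by rw [mul_comm, MvPowerSeries.mul_inv_of_isUnit hf])

theorem derivation_inv (hf : IsUnit f) : d f⁻¹ = -dlog d f * f⁻¹ := by
  have h1 := MvPowerSeries.mul_inv_of_isUnit hf
  have h := congrArg d h1
  rw [Derivation.leibniz, Derivation.map_one_eq_zero, smul_eq_mul, smul_eq_mul] at h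
  rw [dlog]
  linear_combination f⁻¹ * h - d f⁻¹ * h1

theorem dlog_inv (hf : IsUnit f) : dlog d f⁻¹ = -dlog d f :=
  dlog_eq_of_mul_eq (isUnit_inv hf) (derivation_inv hf)

theorem dlog_comm (hdd : ∀ a, d (d' a) = d' (d a)) (hf : IsUnit f) :
    d (dlog d' f) = d' (dlog d f) := by
  simp only [dlog, Derivation.leibniz, smul_eq_mul, derivation_inv hf, hdd]
  ring

theorem dt_comm (i j : ℕ) (f : TimeFun k) : dt k i (dt k j f) = dt k j (dt k i f) :=
  MvPowerSeries.pderiv_comm _ _ f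

theorem dtb_comm (i j : ℕ) (f : TimeFun k) : dtb k i (dtb k j f) = dtb k j (dtb k i f) :=
  MvPowerSeries.pderiv_comm _ _ f

theorem dtb_dt_comm (i j : ℕ) (f : TimeFun k) : dtb k i (dt k j f) = dt k j (dtb k i f) :=
  MvPowerSeries.pderiv_comm _ _ f

end Dlog

/-- Functions with non-vanishing Wronskian are independent over the constants of `∂`. -/
theorem eq_zero_of_seqWronsk_ne_zero {k : Type*} [Field k] {f c : ℕ → TimeFun k} {n : ℕ}
    (hf : seqWronsk f n ≠ 0) (hc : ∀ a < n, dt k 1 (c a) = 0)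
    (h : ∑ a ∈ Finset.range n, f (a + 1) * c a = 0) : ∀ a < n, c a = 0 := by
  have key : ∀ m : ℕ, ∑ a ∈ Finset.range n, (dt k 1)^[m] (f (a + 1)) * c a = 0 := by
    intro m
    induction m with
    | zero => exact h
    | succ m ih =>
      have := congrArg (dt k 1) ih
      rw [map_zero, map_sum] at this
      rw [← this]
      refine Finset.sum_congr rfl fun a ha => ?_
      rw [Derivation.leibniz, hc a (Finset.mem_range.1 ha), Function.iterate_succ_apply',
        smul_zero, zero_add, smul_eq_mul, mul_comm]
  -- The Wronskian matrix annihilates the vector of the `c_a`; power series over a field form a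
  -- domain, so a non-zero determinant suffices.
  have := Matrix.eq_zero_of_mulVec_eq_zero (v := fun a : Fin n => c a) hf (by
    ext1 m
    have := key m
    rw [Finset.sum_range] at this
    simpa [Matrix.mulVec, dotProduct] using this)
  exact fun a ha => congrFun this ⟨a, ha⟩

/-! ### The flows of the squared eigenfunction potentials -/

namespace IsGhostSystem

open PDO

variable {k : Type*} [Field k] {L : PDO (dt k 1)} {τ : TimeFun k}
  {Φ Ψ : ℕ → TimeFun k} {S : ℕ → ℕ → TimeFun k}

theorem dt_one_S (h : IsGhostSystem L τ Φ Ψ S) {i j : ℕ} (hi : 1 ≤ i) (hj : 1 ≤ j) :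
    dt k 1 (S i j) = Φ i * Ψ j := by
  have hp : (L.pow 1).plus = D (dt k 1) 1 := by
    rw [pow_eq, pow_one]
    ext1
    funext n
    simp only [plus, D, coeff_monomial]
    split_ifs with h1 h2 h2
    · rw [h2, h.lax.coeff_one]
    · rcases lt_or_ge 1 n with h3 | h3
      · exact h.lax.coeff_gt_one n h3
      · rw [show n = 0 by omega, h.lax.coeff_zero]
    · omega
    · rfl
  have e : D (dt k 1) 1 * (C (dt k 1) (Φ i) * D (dt k 1) (-1)) =
      C (dt k 1) (dt k 1 (Φ i)) * D (dt k 1) (-1) + C (dt k 1) (Φ i) := by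
    rw [D_one_mul_C_mul, D_mul_D, add_neg_cancel, D_zero, mul_one]
  rw [h.sep i j hi hj 1 le_rfl, hp, e, mul_add, mul_add, res_add, C_mul_C]
  have h1 : (D (dt k 1) (-1) * (C (dt k 1) (Ψ j) *
      (C (dt k 1) (dt k 1 (Φ i)) * D (dt k 1) (-1)))).res = 0 :=
    ((ordLE_D (-1)).mul ((ordLE_C _).mul ((ordLE_C _).mul (ordLE_D (-1))))).res_eq_zero
  have h2 := coeff_mul_top (ordLE_D (δ := dt k 1) (-1)) (ordLE_C (Ψ j * Φ i))
  rw [add_zero] at h2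
  rw [h1, zero_add, res, h2]
  simp [D, C, coeff_monomial, mul_comm]

theorem dtb_Φ (h : IsGhostSystem L τ Φ Ψ S) (s : ℕ) {i : ℕ} (hi : 1 ≤ i) :
    dtb k (s + 1) (Φ i) =
      ∑ p ∈ antidiagonal s, Φ (p.1 + 1) * S i (p.2 + 1) - Φ (i + (s + 1)) := by
  rw [h.flow_Φ (s + 1) i (by omega) hi,
    sum_Icc_eq_sum_antidiagonal s (fun a b => Φ a * S i b)]

theorem dtb_Ψ (h : IsGhostSystem L τ Φ Ψ S) (s : ℕ) {i : ℕ} (hi : 1 ≤ i) :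
    dtb k (s + 1) (Ψ i) =
      ∑ p ∈ antidiagonal s, Ψ (p.2 + 1) * S (p.1 + 1) i + Ψ (i + (s + 1)) := by
  rw [h.flow_Ψ (s + 1) i (by omega) hi,
    sum_Icc_eq_sum_antidiagonal s (fun a b => Ψ b * S a i)]

/-- The ghost flows of the squared eigenfunction potentials. -/
theorem dtb_S (h : IsGhostSystem L τ Φ Ψ S) (r : ℕ) {i j : ℕ} (hi : 1 ≤ i) (hj : 1 ≤ j) :
    dtb k (r + 1) (S i j) =
      ∑ p ∈ antidiagonal r, S (p.1 + 1) j * S i (p.2 + 1) - S (i + (r + 1)) j +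
        S i (j + (r + 1)) := by
  -- `E r j` is the error in the expected formula. Its `∂`-derivative vanishes because `∂S(Φ_i, Ψ_j)
  -- = Φ_i Ψ_j` and the flows of `Φ_i` and `Ψ_j` are known.
  set E : ℕ → ℕ → TimeFun k := fun r j => dtb k (r + 1) (S i j) -
    (∑ p ∈ antidiagonal r, S (p.1 + 1) j * S i (p.2 + 1) - S (i + (r + 1)) j +
        S i (j + (r + 1))) with hE
  have hE0 : ∀ r j, 1 ≤ j → dt k 1 (E r j) = 0 := by
    intro r j hj
    simp only [hE]
    rw [map_sub, ← dtb_dt_comm, h.dt_one_S hi hj, map_add, map_sub, map_sum,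
      h.dt_one_S (by omega) hj, h.dt_one_S hi (by omega), Derivation.leibniz, h.dtb_Φ r hi,
      h.dtb_Ψ r hj, smul_eq_mul, smul_eq_mul]
    have : ∑ p ∈ antidiagonal r, dt k 1 (S (p.1 + 1) j * S i (p.2 + 1)) =
        Φ i * (∑ p ∈ antidiagonal r, Ψ (p.2 + 1) * S (p.1 + 1) j) +
        Ψ j * ∑ p ∈ antidiagonal r, Φ (p.1 + 1) * S i (p.2 + 1) := by
      rw [Finset.mul_sum, Finset.mul_sum, ← Finset.sum_add_distrib]
      refine Finset.sum_congr rfl fun p _ => ?_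
      rw [Derivation.leibniz, h.dt_one_S (by omega) hj, h.dt_one_S hi (by omega), smul_eq_mul,
        smul_eq_mul]
      ring
    rw [this]
    ring
  have hflow : ∀ r j, dtb k (r + 1) (S i j) = E r j +
      (∑ p ∈ antidiagonal r, S (p.1 + 1) j * S i (p.2 + 1) - S (i + (r + 1)) j +
        S i (j + (r + 1))) := fun r j => (sub_add_cancel _ _).symm
  have hcalc : ∀ r s : ℕ, dtb k (r + 1) (dtb k (s + 1) (Φ i)) =
      ∑ p ∈ antidiagonal s, Φ (p.1 + 1) * E r (p.2 + 1) +
      (∑ p ∈ antidiagonal s, ∑ q ∈ antidiagonal r,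
        Φ (q.1 + 1) * S (p.1 + 1) (q.2 + 1) * S i (p.2 + 1) +
      ∑ p ∈ antidiagonal s, ∑ q ∈ antidiagonal r,
        Φ (p.1 + 1) * S (q.1 + 1) (p.2 + 1) * S i (q.2 + 1)) +
      (∑ p ∈ antidiagonal s, Φ (p.1 + 1) * S i (p.2 + 1 + (r + 1)) -
        ∑ p ∈ antidiagonal s, Φ (p.1 + 1 + (r + 1)) * S i (p.2 + 1)) -
      (∑ p ∈ antidiagonal s, Φ (p.1 + 1) * S (i + (r + 1)) (p.2 + 1) +
        ∑ q ∈ antidiagonal r, Φ (q.1 + 1) * S (i + (s + 1)) (q.2 + 1)) +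
      Φ (i + (s + 1) + (r + 1)) := by
    intro r s
    have : ∑ p ∈ antidiagonal s, dtb k (r + 1) (Φ (p.1 + 1) * S i (p.2 + 1)) =
        ∑ p ∈ antidiagonal s, (Φ (p.1 + 1) * E r (p.2 + 1) +
          (∑ q ∈ antidiagonal r, Φ (q.1 + 1) * S (p.1 + 1) (q.2 + 1) * S i (p.2 + 1) +
            ∑ q ∈ antidiagonal r, Φ (p.1 + 1) * S (q.1 + 1) (p.2 + 1) * S i (q.2 + 1)) +
          (Φ (p.1 + 1) * S i (p.2 + 1 + (r + 1)) - Φ (p.1 + 1 + (r + 1)) * S i (p.2 + 1)) -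
          Φ (p.1 + 1) * S (i + (r + 1)) (p.2 + 1)) := by
      refine Finset.sum_congr rfl fun p _ => ?_
      rw [Derivation.leibniz, h.dtb_Φ r (by omega), hflow, smul_eq_mul, smul_eq_mul,
        ← Finset.sum_mul]
      simp only [mul_assoc]
      rw [← Finset.mul_sum]
      ring
    rw [h.dtb_Φ s hi, map_sub, map_sum, this, h.dtb_Φ r (by omega)]
    simp only [Finset.sum_add_distrib, Finset.sum_sub_distrib]
    ring
  -- The two ghost flows commute on `Φ_i`. Apart from the errors, the expansion `hcalc` is symmetric
  -- in `r` and `s`, so only a relation between the errors remains.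
  have hrel : ∀ r s : ℕ, ∑ p ∈ antidiagonal s, Φ (p.1 + 1) * E r (p.2 + 1) =
      ∑ p ∈ antidiagonal r, Φ (p.1 + 1) * E s (p.2 + 1) := by
    intro r s
    have h1 := dtb_comm (r + 1) (s + 1) (Φ i)
    rw [hcalc r s, hcalc s r, sum_antidiagonal_shift_comm r s (fun a b => Φ a * S i b)] at h1
    have h2 : ∀ r s : ℕ, ∑ p ∈ antidiagonal s, ∑ q ∈ antidiagonal r,
        Φ (q.1 + 1) * S (p.1 + 1) (q.2 + 1) * S i (p.2 + 1) =
        ∑ p ∈ antidiagonal r, ∑ q ∈ antidiagonal s,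
        Φ (p.1 + 1) * S (q.1 + 1) (p.2 + 1) * S i (q.2 + 1) := fun r s => Finset.sum_comm
    rw [h2 r s, ← h2 s r, add_right_comm i (s + 1) (r + 1)] at h1
    linear_combination h1
  obtain ⟨j, rfl⟩ := Nat.exists_eq_succ_of_ne_zero (by omega : j ≠ 0)
  -- The second flow is taken long enough, `s = r + 1 + j` in the shifted index, that `Φ_{r+2}`
  -- occurs on one side of `hrel` only; its coefficient there is the error to be killed.
  have hz := eq_zero_of_seqWronsk_ne_zero (h.wronsk_Φ (r + 1 + j + 1))
    (c := fun a => E r (r + 1 + j - a + 1) - if a ≤ r then E (r + 1 + j) (r - a + 1) else 0)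
    (fun a _ => by
      rw [map_sub, hE0 _ _ (by omega)]
      split_ifs
      · rw [hE0 _ _ (by omega), sub_zero]
      · rw [map_zero, sub_zero]) (by
      have h1 := hrel r (r + 1 + j)
      rw [Finset.Nat.sum_antidiagonal_eq_sum_range_succ_mk,
        Finset.Nat.sum_antidiagonal_eq_sum_range_succ_mk] at h1
      simp only [mul_sub, Finset.sum_sub_distrib]
      rw [← Nat.succ_eq_add_one (r + 1 + j), h1, sub_eq_zero]
      rw [← Finset.sum_subset (Finset.range_subset_range.2 (by omega :
        r + 1 ≤ (r + 1 + j).succ))]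
      · refine Finset.sum_congr rfl fun a ha => ?_
        rw [if_pos (by have := Finset.mem_range.1 ha; omega)]
      · intro a _ ha
        rw [if_neg (by rw [Finset.mem_range] at ha; omega), mul_zero]) (r + 1) (by omega)
  rw [if_neg (by omega), sub_zero, show r + 1 + j - (r + 1) + 1 = j.succ by omega] at hz
  exact sub_eq_zero.1 hz

/-- The defect `∂_{t̄_s} ln τ + ∑ ∂⁻¹(Φ_{s-j+1} Ψ_j)` does not depend on `t`. -/
theorem dt_defect [CharZero k] (h : IsGhostSystem L τ Φ Ψ S) (l s : ℕ) :
    dt k (l + 1) (dlog (dtb k (s + 1)) τ + ∑ p ∈ antidiagonal s, S (p.1 + 1) (p.2 + 1)) = 0 := by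
  have := deriv_dlog_of_flow (Finset.Icc 1 (s + 1)) (F := fun j => Φ (s + 1 - j + 1)) (G := Ψ)
    (P := fun j => S (s + 1 - j + 1) j) (dtb k (s + 1)) dt_comm (fun i f => dtb_dt_comm _ _ f)
    h.tau (fun j _ => h.eigen _ (by omega))
    (fun j hj => h.adjEigen j (Finset.mem_Icc.1 hj).1)
    (fun j hj => h.sep _ j (by omega) (Finset.mem_Icc.1 hj).1)
    (h.flow_W (s + 1) (by omega)) l
  rw [map_add, ← dlog_comm (dtb_dt_comm _ _) h.tau.isUnit, this,
    sum_Icc_eq_sum_antidiagonal s (fun a b => S a b), neg_add_cancel]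

/-- The defects form a closed one-form in `t̄`. -/
theorem dtb_defect_comm (h : IsGhostSystem L τ Φ Ψ S) (r s : ℕ) :
    dtb k (r + 1) (dlog (dtb k (s + 1)) τ + ∑ p ∈ antidiagonal s, S (p.1 + 1) (p.2 + 1)) =
    dtb k (s + 1) (dlog (dtb k (r + 1)) τ + ∑ p ∈ antidiagonal r, S (p.1 + 1) (p.2 + 1)) := by
  have hc : ∀ r s : ℕ, dtb k (r + 1) (∑ p ∈ antidiagonal s, S (p.1 + 1) (p.2 + 1)) =
      ∑ p ∈ antidiagonal s, ∑ q ∈ antidiagonal r, S (q.1 + 1) (p.2 + 1) * S (p.1 + 1) (q.2 + 1) +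
      (∑ p ∈ antidiagonal s, S (p.1 + 1) (p.2 + 1 + (r + 1)) -
        ∑ p ∈ antidiagonal s, S (p.1 + 1 + (r + 1)) (p.2 + 1)) := by
    intro r s
    rw [map_sum, ← Finset.sum_sub_distrib, ← Finset.sum_add_distrib]
    refine Finset.sum_congr rfl fun p _ => ?_
    rw [h.dtb_S r (by omega) (by omega)]
    ring
  rw [map_add, map_add, dlog_comm (dtb_comm _ _) h.tau.isUnit, hc r s, hc s r,
    sum_antidiagonal_shift_comm, Finset.sum_comm]
  simp only [mul_comm]

/-- The normalization of the tau-function. -/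
theorem exists_normalized_tau [CharZero k] (h : IsGhostSystem L τ Φ Ψ S) :
    ∃ c : TimeFun k, IsUnit c ∧ (∀ l, 1 ≤ l → dt k l c = 0) ∧ ∀ s,
      dlog (dtb k (s + 1)) (c * τ) = -∑ p ∈ antidiagonal s, S (p.1 + 1) (p.2 + 1) := by
  set e : ℕ → TimeFun k := fun s =>
    dlog (dtb k (s + 1)) τ + ∑ p ∈ antidiagonal s, S (p.1 + 1) (p.2 + 1) with he
  -- The one-form has no components along `t` and minus the defect along `t̄`. The mixed closedness
  -- conditions are `dt_defect`, those within `t̄` are `dtb_defect_comm`.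
  obtain ⟨c, hc, hce⟩ := MvPowerSeries.exists_unit_pderiv_eq (k := k)
    (Sum.elim (fun _ : ℕ => 0) (fun s : ℕ => -e s)) (by
      rintro (i | i) (j | j)
      · simp
      · simp only [Sum.elim_inl, Sum.elim_inr, map_neg, map_zero]
        exact neg_eq_zero.2 (h.dt_defect i j)
      · simp only [Sum.elim_inl, Sum.elim_inr, map_neg, map_zero]
        exact (neg_eq_zero.2 (h.dt_defect j i)).symm
      · simp only [Sum.elim_inr, map_neg]
        exact congrArg Neg.neg (h.dtb_defect_comm i j))
  refine ⟨c, hc, fun l _ => ?_, fun s => ?_⟩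
  · have := hce (Sum.inl (l - 1))
    rwa [Sum.elim_inl, zero_mul] at this
  · have h1 : dlog (dtb k (s + 1)) c = -e s := dlog_eq_of_mul_eq hc (hce (Sum.inr s))
    rw [dlog_mul hc h.tau.isUnit, h1]
    simp only [he]
    ring

end IsGhostSystem

/-- Multiplying a tau-function by an invertible constant gives a tau-function. -/
theorem IsTauFunction.const_mul {k : Type*} [Field k] [CharZero k]
    {d : ℕ → Derivation k (TimeFun k) (TimeFun k)} {L : PDO (d 1)} {τ c : TimeFun k}
    (hd : ∀ i j f, d i (d j f) = d j (d i f)) (h : IsTauFunction d L τ) (hc : IsUnit c)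
    (hc' : ∀ l, 1 ≤ l → d l c = 0) : IsTauFunction d L (c * τ) := by
  have hW : dressing d (c * τ) = dressing d τ := by
    ext n
    simp only [dressing]
    split_ifs
    · rfl
    · rw [schurOp_const_mul hd hc', MvPowerSeries.mul_inv_rev, mul_comm τ⁻¹, mul_mul_mul_comm,
        MvPowerSeries.mul_inv_of_isUnit hc, one_mul]
  refine ⟨hc.mul h.isUnit, by rw [hW, h.dress], fun l hl => by rw [hW, h.sato l hl],
    fun l hl => ?_⟩
  rw [dlog_mul hc h.isUnit, dlog, hc' l hl, zero_mul, zero_add, h.res l hl]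

/-! ### Darboux transformations and Wronskians -/

section Darboux

variable {k : Type*} [Field k] {Ψ : ℕ → TimeFun k}

/-- The monic differential operator of order `n` which annihilates `Ψ_1, …, Ψ_n`, as a product
of first order factors. -/
noncomputable def darboux (Ψ : ℕ → TimeFun k) : ℕ → TimeFun k → TimeFun k
  | 0, g => g
  | n + 1, g => dt k 1 (darboux Ψ n g) -
      darboux Ψ n g * dlog (dt k 1) (darboux Ψ n (Ψ (n + 1)))

/-- The coefficients do not depend on `g` and the leading one is `1`, so `darboux Ψ n` acts as a row
operation on Wronskian matrices. -/
theorem darboux_eq_sum (n : ℕ) : ∃ c : ℕ → TimeFun k, c n = 1 ∧ (∀ m, n < m → c m = 0) ∧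
    ∀ g, darboux Ψ n g = ∑ a ∈ Finset.range (n + 1), c a * (dt k 1)^[a] g := by
  induction n with
  | zero => exact ⟨fun m => if m = 0 then 1 else 0, by simp, fun m hm => by simp; omega,
      fun g => by simp [darboux]⟩
  | succ n ih =>
    obtain ⟨c, hc1, hc0, hc⟩ := ih
    set b := dlog (dt k 1) (darboux Ψ n (Ψ (n + 1))) with hb
    refine ⟨fun m => (if m = 0 then 0 else c (m - 1)) + dt k 1 (c m) - c m * b, ?_, ?_, ?_⟩
    · simp [hc1, hc0]
    · intro m hm
      simp [hc0 m (by omega), hc0 (m - 1) (by omega)]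
    · intro g
      have h1 : ∑ a ∈ Finset.range (n + 1), c a * (dt k 1)^[a] g =
          ∑ a ∈ Finset.range (n + 1 + 1), c a * (dt k 1)^[a] g := by
        rw [Finset.sum_range_succ _ (n + 1), hc0 (n + 1) (by omega), zero_mul, add_zero]
      have h2 : ∑ a ∈ Finset.range (n + 1), dt k 1 (c a) * (dt k 1)^[a] g =
          ∑ a ∈ Finset.range (n + 1 + 1), dt k 1 (c a) * (dt k 1)^[a] g := by
        rw [Finset.sum_range_succ _ (n + 1), hc0 (n + 1) (by omega), map_zero, zero_mul, add_zero]
      have h3 : dt k 1 (∑ a ∈ Finset.range (n + 1), c a * (dt k 1)^[a] g) =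
          ∑ a ∈ Finset.range (n + 1), c a * (dt k 1)^[a + 1] g +
            ∑ a ∈ Finset.range (n + 1), dt k 1 (c a) * (dt k 1)^[a] g := by
        rw [map_sum, ← Finset.sum_add_distrib]
        refine Finset.sum_congr rfl fun a _ => ?_
        rw [Derivation.leibniz, Function.iterate_succ_apply', smul_eq_mul, smul_eq_mul]
        ring
      simp only [darboux]
      rw [← hb, hc, h3, h2, h1]
      simp only [sub_mul, add_mul, Finset.sum_sub_distrib, Finset.sum_add_distrib]
      rw [Finset.sum_range_succ' (fun a => (if a = 0 then 0 else c (a - 1)) * (dt k 1)^[a] g)]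
      simp only [Nat.add_sub_cancel, if_true, zero_mul, add_zero, Nat.succ_ne_zero, if_false]
      rw [Finset.sum_mul]
      congr 1
      exact Finset.sum_congr rfl fun a _ => by ring

/-- Adding to the last row of the Wronskian matrix the combination of the earlier rows prescribed by
`darboux` keeps the determinant and leaves a single entry in that row, under `g`. -/
theorem seqWronskAppend_eq_mul_darboux {n : ℕ} (h : ∀ i < n, darboux Ψ n (Ψ (i + 1)) = 0)
    (g : TimeFun k) : seqWronskAppend Ψ n g = seqWronsk Ψ n * darboux Ψ n g := by
  obtain ⟨c, hc1, -, hc⟩ := darboux_eq_sum (Ψ := Ψ) n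
  set f : Fin (n + 1) → TimeFun k :=
    Fin.snoc (α := fun _ => TimeFun k) (fun i : Fin n => Ψ (i + 1)) g with hf
  set M : Matrix (Fin (n + 1)) (Fin (n + 1)) (TimeFun k) :=
    Matrix.of fun α β => (dt k 1)^[(α : ℕ)] (f β) with hM
  have h1 := Matrix.det_updateRow_sum M (Fin.last n) (fun a => c a)
  rw [Fin.val_last, hc1, one_smul] at h1
  have hrow : ∀ β, (∑ a : Fin (n + 1), c a • M a) β = darboux Ψ n (f β) := by
    intro β
    rw [hc, Finset.sum_range, Finset.sum_apply]
    rfl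
  change M.det = _
  rw [← h1, Matrix.det_succ_row _ (Fin.last n), Finset.sum_eq_single (Fin.last n)]
  · have hsub : (M.updateRow (Fin.last n) (∑ a : Fin (n + 1), c a • M a)).submatrix
        (Fin.last n).succAbove (Fin.last n).succAbove =
        Matrix.of fun α β : Fin n => (dt k 1)^[(α : ℕ)] (Ψ (β + 1)) := by
      ext1 α β
      simp [Matrix.updateRow_apply, hM, hf, (Fin.castSucc_lt_last α).ne]
    rw [hsub, Matrix.updateRow_self, hrow, Even.neg_one_pow (by simp), one_mul, mul_comm]
    congr 2
    simp [hf]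
  · intro β _ hβ
    obtain ⟨i, rfl⟩ := Fin.exists_castSucc_eq.2 hβ
    rw [Matrix.updateRow_self, hrow]
    have : f i.castSucc = Ψ (i + 1) := by simp [hf]
    rw [this, h i i.2, mul_zero, zero_mul]
  · intro hn
    exact absurd (Finset.mem_univ _) hn

theorem seqWronsk_succ_eq_append (n : ℕ) :
    seqWronsk Ψ (n + 1) = seqWronskAppend Ψ n (Ψ (n + 1)) := by
  rw [seqWronsk, seqWronskAppend]
  congr 1
  funext i
  induction i using Fin.lastCases with
  | last => simp
  | cast i => simp

/-- By induction `darboux Ψ n Ψ_{n+1}` is the factor by which `𝒲_{n+1}` exceeds `𝒲_n`, hence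
invertible. The next first-order factor is then built to annihilate it and keeps the earlier zeros.
-/
theorem darboux_eq_zero (hΨ : ∀ n, IsUnit (seqWronsk Ψ n)) (n : ℕ) :
    ∀ i < n, darboux Ψ n (Ψ (i + 1)) = 0 := by
  induction n with
  | zero => intro i hi; omega
  | succ n ih =>
    intro i hi
    rw [darboux]
    rcases Nat.lt_succ_iff_lt_or_eq.1 hi with h | rfl
    · rw [ih i h, map_zero, zero_mul, sub_zero]
    · have hu : IsUnit (darboux Ψ i (Ψ (i + 1))) := by
        have := hΨ (i + 1)
        rw [seqWronsk_succ_eq_append, seqWronskAppend_eq_mul_darboux ih] at this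
        exact isUnit_of_mul_isUnit_right this
      rw [mul_comm, dlog_mul_self hu, sub_self]

theorem isUnit_darboux (hΨ : ∀ n, IsUnit (seqWronsk Ψ n)) (n : ℕ) :
    IsUnit (darboux Ψ n (Ψ (n + 1))) := by
  have := hΨ (n + 1)
  rw [seqWronsk_succ_eq_append, seqWronskAppend_eq_mul_darboux (darboux_eq_zero hΨ n)] at this
  exact isUnit_of_mul_isUnit_right this

/-- The quotients `𝒲_{j-1}(Ψ_i) / 𝒲_j`. -/
theorem seqWronskAppend_mul_inv (hΨ : ∀ n, IsUnit (seqWronsk Ψ n)) (n i : ℕ) :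
    seqWronskAppend Ψ n (Ψ i) * (seqWronsk Ψ (n + 1))⁻¹ =
      darboux Ψ n (Ψ i) * (darboux Ψ n (Ψ (n + 1)))⁻¹ := by
  have h0 := darboux_eq_zero hΨ n
  rw [seqWronsk_succ_eq_append, seqWronskAppend_eq_mul_darboux h0,
    seqWronskAppend_eq_mul_darboux h0, MvPowerSeries.mul_inv_rev]
  linear_combination (darboux Ψ n (Ψ i) * (darboux Ψ n (Ψ (n + 1)))⁻¹) *
    MvPowerSeries.mul_inv_of_isUnit (hΨ n)

theorem seqWronsk_succ_mul_inv (hΨ : ∀ n, IsUnit (seqWronsk Ψ n)) (n : ℕ) :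
    seqWronsk Ψ (n + 1) * (seqWronsk Ψ n)⁻¹ = darboux Ψ n (Ψ (n + 1)) := by
  rw [seqWronsk_succ_eq_append, seqWronskAppend_eq_mul_darboux (darboux_eq_zero hΨ n)]
  linear_combination (darboux Ψ n (Ψ (n + 1))) * MvPowerSeries.mul_inv_of_isUnit (hΨ n)

end Darboux

/-! ### Wronskian quotients under the first ghost flow. -/

namespace IsGhostSystem

open PDO

variable {k : Type*} [Field k] {L : PDO (dt k 1)} {τ : TimeFun k}
  {Φ Ψ : ℕ → TimeFun k} {S : ℕ → ℕ → TimeFun k}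

/-- The coefficients `𝒲_{j-1}(Ψ_i) / 𝒲_j` for `j ≥ 1`, continued by `-∂⁻¹(Φ_1 Ψ_i)` to `j = 0`. -/
noncomputable def ghostCoeff (Ψ : ℕ → TimeFun k) (S : ℕ → ℕ → TimeFun k) : ℕ → ℕ → TimeFun k
  | 0, i => -S 1 i
  | n + 1, i => darboux Ψ n (Ψ i) * (darboux Ψ n (Ψ (n + 1)))⁻¹

/-- The first ghost flow of the Darboux transformed adjoint eigenfunctions. -/
theorem dtb_darboux (h : IsGhostSystem L τ Φ Ψ S) (n : ℕ) : ∀ i, 1 ≤ i →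
    dtb k 1 (darboux Ψ n (Ψ i)) = darboux Ψ n (Ψ (i + 1)) -
      darboux Ψ n (Ψ (n + 1)) * ghostCoeff Ψ S n i := by
  -- The `∂`-derivatives of the coefficients are proportional to `darboux Ψ n (Ψ i)` with a factor
  -- `q` independent of `i`. This also holds at `n = 0`, thanks to the continuation by `-S(Φ_1,
  -- Ψ_i)`, and it makes the induction uniform.
  have hh : ∀ n, ∃ q, ∀ i, 1 ≤ i → dt k 1 (ghostCoeff Ψ S n i) = q * darboux Ψ n (Ψ i) := by
    intro n
    rcases n with _ | n
    · refine ⟨-Φ 1, fun i hi => ?_⟩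
      rw [ghostCoeff, map_neg, h.dt_one_S le_rfl hi, darboux, neg_mul]
    · refine ⟨(darboux Ψ n (Ψ (n + 1)))⁻¹, fun i _ => ?_⟩
      rw [ghostCoeff, darboux, Derivation.leibniz, derivation_inv (isUnit_darboux h.wronsk_Ψ n),
        smul_eq_mul, smul_eq_mul]
      ring
  induction n with
  | zero =>
    intro i hi
    rw [darboux, darboux, darboux, ghostCoeff, h.dtb_Ψ 0 hi]
    simp
    ring
  | succ n ih =>
    intro i hi
    obtain ⟨q, hq⟩ := hh n
    have hu := MvPowerSeries.mul_inv_of_isUnit (isUnit_darboux h.wronsk_Ψ n)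
    have e1 := congrArg (dt k 1) (ih i hi)
    have e2 := congrArg (dt k 1) (ih (n + 1) (by omega))
    rw [map_sub, Derivation.leibniz, hq _ hi, ← dtb_dt_comm] at e1
    rw [map_sub, Derivation.leibniz, hq _ (by omega), ← dtb_dt_comm] at e2
    have e3 := derivation_inv (d := dtb k 1) (isUnit_darboux h.wronsk_Ψ n)
    have hg : ghostCoeff Ψ S (n + 1) i = darboux Ψ n (Ψ i) * (darboux Ψ n (Ψ (n + 1)))⁻¹ := rfl
    simp only [darboux, hg, dlog, map_sub, Derivation.leibniz, smul_eq_mul] at e1 e2 e3 ⊢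
    rw [e3, e1, e2, ih i hi, ih (n + 1) (by omega)]
    generalize darboux Ψ n (Ψ (n + 1)) = g at *
    generalize g⁻¹ = y at *
    generalize darboux Ψ n (Ψ i) = x at *
    linear_combination (dt k 1 g * ghostCoeff Ψ S n i + g * q * x -
      x * dt k 1 g * y * ghostCoeff Ψ S n (n + 1)) * hu

/-- The logarithmic derivative is the one appearing in the next ghost factor, so this is the
relation that makes the sum in `ghostPotential_eq_sum` telescope after applying `D̄`. -/
theorem dtb_ghostCoeff (h : IsGhostSystem L τ Φ Ψ S) (n : ℕ) {i : ℕ} (hi : 1 ≤ i) :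
    dtb k 1 (ghostCoeff Ψ S (n + 1) i) +
      ghostCoeff Ψ S (n + 1) i * dlog (dtb k 1) (darboux Ψ n (Ψ (n + 1))) =
    ghostCoeff Ψ S (n + 1) (i + 1) - ghostCoeff Ψ S n i := by
  have hu := isUnit_darboux h.wronsk_Ψ n
  have hu' := MvPowerSeries.mul_inv_of_isUnit hu
  rw [ghostCoeff, ghostCoeff, Derivation.leibniz, derivation_inv hu, h.dtb_darboux n i hi,
    smul_eq_mul, smul_eq_mul]
  linear_combination -ghostCoeff Ψ S n i * hu'

theorem ghostCoeff_self (h : IsGhostSystem L τ Φ Ψ S) (n : ℕ) :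
    ghostCoeff Ψ S (n + 1) (n + 1) = 1 :=
  MvPowerSeries.mul_inv_of_isUnit (isUnit_darboux h.wronsk_Ψ n)

/-! ### The ghost dressing operator -/

/-- `∑_{n ≥ 0} Φ_{n+1} D̄^{-n}`. -/
noncomputable def ghostSeries (Φ : ℕ → TimeFun k) : PDO (dtb k 1) :=
  ⟨fun n => if 0 < n then 0 else Φ (1 - n).toNat, 0, fun _ hn => if_pos hn⟩

/-- `D̄^j + ∑_{i ≥ 1} ∂⁻¹(Φ_i Ψ_j) D̄^{1-i}`. -/
noncomputable def ghostPotential (S : ℕ → ℕ → TimeFun k) (j : ℕ) : PDO (dtb k 1) :=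
  ⟨fun n => if 0 < n then (if n = j then 1 else 0) else S (1 - n).toNat j, j, fun n hn => by
    rw [if_pos (by omega), if_neg (by omega)]⟩

theorem coeff_ghostSeries (n : ℤ) :
    (ghostSeries Φ).coeff n = if 0 < n then 0 else Φ (1 - n).toNat := rfl

theorem coeff_ghostPotential (j : ℕ) (n : ℤ) : (ghostPotential S j).coeff n =
    if 0 < n then (if n = j then 1 else 0) else S (1 - n).toNat j := rfl

/-- In powers `D̄^{-n}` this is the first ghost flow of the potentials; the positive powers match by
the shift, with `S(Φ_1, Ψ_j)` entering at `D̄`. -/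
theorem D_mul_ghostPotential (h : IsGhostSystem L τ Φ Ψ S) {j : ℕ} (hj : 1 ≤ j) :
    D (dtb k 1) 1 * ghostPotential S j =
      ghostPotential S (j + 1) + C (dtb k 1) (S 1 j) * ghostPotential S 1 := by
  ext1
  funext n
  rw [coeff_D_one_mul, coeff_add, coeff_C_mul]
  simp only [coeff_ghostPotential]
  rcases lt_trichotomy n 1 with hn | rfl | hn
  · obtain ⟨i, rfl⟩ : ∃ i : ℕ, n = -i := ⟨(-n).toNat, by omega⟩
    rw [if_neg (by omega), if_neg (by omega), if_neg (by omega), if_neg (by omega),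
      show (1 - -(i : ℤ)).toNat = i + 1 by omega, show (1 - (-(i : ℤ) - 1)).toNat = i + 1 + 1 by omega]
    have := h.dtb_S 0 (i := i + 1) (j := j) (by omega) hj
    rw [Finset.Nat.antidiagonal_zero, Finset.sum_singleton] at this
    simp only [zero_add] at this
    rw [this]
    ring
  · have hj0 : j ≠ 0 := by omega
    rw [if_neg (by omega : ¬ (0 : ℤ) < 1 - 1), show (1 - (1 - 1) : ℤ).toNat = 1 from rfl]
    simp only [if_pos (one_pos : (0 : ℤ) < 1), if_neg (by omega : ¬ (1 : ℤ) = ((j + 1 : ℕ) : ℤ)),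
      if_pos (Nat.cast_one.symm : (1 : ℤ) = ((1 : ℕ) : ℤ)), mul_one, zero_add]
    split_ifs <;> simp
  · have h0 : 0 < n := by omega
    have h1 : 0 < n - 1 := by omega
    have : n - 1 = j ↔ n = ((j + 1 : ℕ) : ℤ) := by omega
    simp only [if_pos h0, if_pos h1, if_neg (by omega : ¬ n = ((1 : ℕ) : ℤ)), mul_zero, add_zero,
      this]
    split_ifs <;> simp

/-- In non-positive powers the shift by `D̄^s` cancels the term `-Φ_{i+s}` of the flow. In positive
powers it creates `Φ_{s-j+1} D̄^j`, which is why the potentials are completed by `D̄^j`. -/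
theorem flow_ghostSeries (h : IsGhostSystem L τ Φ Ψ S) (s : ℕ) :
    PDO.deriv (dtb k (s + 1)) (ghostSeries Φ) + ghostSeries Φ * D (dtb k 1) (s + 1 : ℕ) =
      ∑ j ∈ Finset.Icc 1 (s + 1), C (dtb k 1) (Φ (s + 1 - j + 1)) * ghostPotential S j := by
  ext1
  funext n
  rw [coeff_add, coeff_deriv, coeff_mul_D, coeff_sum]
  simp only [coeff_C_mul, coeff_ghostPotential, coeff_ghostSeries]
  rcases le_or_gt n 0 with hn | hn
  · obtain ⟨i, rfl⟩ : ∃ i : ℕ, n = -i := ⟨(-n).toNat, by omega⟩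
    simp only [if_neg (by omega : ¬ 0 < -(i : ℤ))]
    rw [if_neg (by omega), show (1 - -(i : ℤ)).toNat = i + 1 by omega,
      h.flow_Φ (s + 1) (i + 1) (by omega) (by omega),
      show (1 - (-(i : ℤ) - (s + 1 : ℕ))).toNat = i + 1 + (s + 1) by omega, sub_add_cancel]
  · simp only [if_pos hn, map_zero, zero_add]
    split_ifs with h1
    · rw [Finset.sum_eq_zero]
      intro j hj
      rw [Finset.mem_Icc] at hj
      rw [if_neg (by omega), mul_zero]
    · rw [Finset.sum_eq_single n.toNat]
      · rw [if_pos (by omega), mul_one]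
        congr 1
        omega
      · intro j _ hj
        rw [if_neg (by omega), mul_zero]
      · intro hn'
        exact absurd (Finset.mem_Icc.2 (by omega)) hn'

/-- The potentials in terms of the ghost factors applied to the ghost dressing operator. -/
theorem ghostPotential_eq_sum (h : IsGhostSystem L τ Φ Ψ S) (i : ℕ) :
    ghostPotential S (i + 1) = ∑ j ∈ Finset.range (i + 1),
      C (dtb k 1) (ghostCoeff Ψ S (j + 1) (i + 1)) *
        (ghostFactors Φ Ψ (j + 1) * (C (dtb k 1) (Φ 1)⁻¹ * ghostSeries Φ)) := by
  have hΦ := h.isUnit_Φ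
  set Wb := C (dtb k 1) (Φ 1)⁻¹ * ghostSeries Φ with hWb
  have hY1 : ghostFactors Φ Ψ 1 * Wb = ghostPotential S 1 := by
    have h1 := h.flow_ghostSeries 0
    simp only [zero_add, Nat.cast_one, Finset.Icc_self, Finset.sum_singleton, Nat.sub_self] at h1
    rw [← D_one_mul_eq] at h1
    rw [ghostFactors, sub_mul, hWb, D_one_mul_C_mul, h1, C_mul_C_mul, C_mul_C_mul, dlog_inv hΦ,
      derivation_inv hΦ, mul_comm (Φ 1)⁻¹, MvPowerSeries.mul_inv_of_isUnit hΦ, C_one, one_mul,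
      add_sub_cancel_left]
  have hY : ∀ j, D (dtb k 1) 1 * (ghostFactors Φ Ψ (j + 1) * Wb) =
      ghostFactors Φ Ψ (j + 2) * Wb +
        C (dtb k 1) (dlog (dtb k 1) (darboux Ψ j (Ψ (j + 1)))) *
          (ghostFactors Φ Ψ (j + 1) * Wb) := by
    intro j
    rw [ghostFactors, seqWronsk_succ_mul_inv h.wronsk_Ψ, sub_mul, sub_mul, mul_assoc, mul_assoc,
      sub_add_cancel]
  induction i with
  | zero => simp only [zero_add, Finset.sum_range_one, h.ghostCoeff_self 0, C_one, one_mul, hY1]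
  | succ i ih =>
    have h1 := h.D_mul_ghostPotential (j := i + 1) (by omega)
    rw [← sub_eq_iff_eq_add] at h1
    rw [← h1, ih, Finset.mul_sum]
    -- The last two terms telescope. The lower end, at `j = 0`, cancels the correction `S(Φ_1,
    -- Ψ_{i+1}) P_1`; the upper end has coefficient `1` and supplies the new summand.
    have h2 : ∀ j ∈ Finset.range (i + 1), D (dtb k 1) 1 *
        (C (dtb k 1) (ghostCoeff Ψ S (j + 1) (i + 1)) * (ghostFactors Φ Ψ (j + 1) * Wb)) =
        C (dtb k 1) (ghostCoeff Ψ S (j + 1) (i + 1 + 1)) * (ghostFactors Φ Ψ (j + 1) * Wb) +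
        (C (dtb k 1) (ghostCoeff Ψ S (j + 1) (i + 1)) * (ghostFactors Φ Ψ (j + 1 + 1) * Wb) -
          C (dtb k 1) (ghostCoeff Ψ S j (i + 1)) * (ghostFactors Φ Ψ (j + 1) * Wb)) := by
      intro j _
      have e := h.dtb_ghostCoeff j (i := i + 1) (by omega)
      rw [← eq_sub_iff_add_eq] at e
      rw [D_one_mul_C_mul, hY, mul_add, C_mul_C_mul, e, sub_sub, sub_eq_add_neg, C_add, C_neg,
        C_add]
      simp only [add_mul, neg_mul]
      abel
    rw [Finset.sum_congr rfl h2, Finset.sum_add_distrib, Finset.sum_range_sub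
      (fun j => C (dtb k 1) (ghostCoeff Ψ S j (i + 1)) * (ghostFactors Φ Ψ (j + 1) * Wb)),
      h.ghostCoeff_self i, zero_add, hY1, ghostCoeff, C_neg, neg_mul, C_one, one_mul,
      Finset.sum_range_succ _ (i + 1), h.ghostCoeff_self (i + 1), C_one, one_mul]
    abel

/-- Substituting the factorized potentials into `flow_ghostSeries` and exchanging the two sums gives
the sum in `M̄_s`; differentiating the prefactor `Φ_1⁻¹` gives its term `-∂_{t̄_s} ln Φ_1`. -/
theorem flow_ghostDressing (h : IsGhostSystem L τ Φ Ψ S) (s : ℕ) :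
    PDO.deriv (dtb k (s + 1)) (C (dtb k 1) (Φ 1)⁻¹ * ghostSeries Φ) +
      C (dtb k 1) (Φ 1)⁻¹ * ghostSeries Φ * D (dtb k 1) (s + 1 : ℕ) =
      ghostMbar Φ Ψ (s + 1) * (C (dtb k 1) (Φ 1)⁻¹ * ghostSeries Φ) := by
  have hΦ := h.isUnit_Φ
  have hfl := h.flow_ghostSeries s
  rw [← eq_sub_iff_add_eq] at hfl
  have hP : ∀ j ∈ Finset.Icc 1 (s + 1), ghostPotential S j = ∑ i ∈ Finset.Icc 1 j,
      C (dtb k 1) (seqWronskAppend Ψ (i - 1) (Ψ j) * (seqWronsk Ψ i)⁻¹) *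
        (ghostFactors Φ Ψ i * (C (dtb k 1) (Φ 1)⁻¹ * ghostSeries Φ)) := by
    intro j hj
    obtain ⟨j, rfl⟩ := Nat.exists_eq_succ_of_ne_zero (by rw [Finset.mem_Icc] at hj; omega : j ≠ 0)
    rw [Nat.succ_eq_add_one, h.ghostPotential_eq_sum, Finset.range_eq_Ico, Finset.sum_Ico_add'
      (fun i => C (dtb k 1) (ghostCoeff Ψ S i (j + 1)) *
        (ghostFactors Φ Ψ i * (C (dtb k 1) (Φ 1)⁻¹ * ghostSeries Φ))) 0 (j + 1) 1]
    refine Finset.sum_congr rfl fun i hi => ?_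
    obtain ⟨i, rfl⟩ := Nat.exists_eq_succ_of_ne_zero (by rw [Finset.mem_Icc] at hi; omega : i ≠ 0)
    rw [Nat.succ_eq_add_one, Nat.add_sub_cancel, seqWronskAppend_mul_inv h.wronsk_Ψ, ghostCoeff]
  rw [deriv_mul (dtb_comm _ _), deriv_C, derivation_inv hΦ, hfl, mul_sub, Finset.mul_sum]
  simp only [ghostMbar, sub_mul, Finset.sum_mul, C_sum, neg_mul, C_neg, C_mul_C_mul, mul_assoc]
  rw [Finset.sum_comm' (t' := Finset.Icc 1 (s + 1)) (s' := fun i => Finset.Icc 1 i) (by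
    intro j i
    simp only [Finset.mem_Icc]
    omega)]
  have : ∀ j ∈ Finset.Icc 1 (s + 1), C (dtb k 1) ((Φ 1)⁻¹ * Φ (s + 1 - j + 1)) *
      ghostPotential S j = ∑ i ∈ Finset.Icc 1 j, C (dtb k 1) (Φ (s + 1 - j + 1) * ((Φ 1)⁻¹ *
        (seqWronskAppend Ψ (i - 1) (Ψ j) * (seqWronsk Ψ i)⁻¹))) *
        (ghostFactors Φ Ψ i * (C (dtb k 1) (Φ 1)⁻¹ * ghostSeries Φ)) := by
    intro j hj
    rw [hP j hj, Finset.mul_sum]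
    refine Finset.sum_congr rfl fun i _ => ?_
    rw [C_mul_C_mul]
    congr 2
    ring
  rw [Finset.sum_congr rfl this]
  abel

theorem isDiff_ghostMbar (s : ℕ) : IsDiff (ghostMbar Φ Ψ s) := by
  have hD : IsDiff (D (dtb k 1) 1) := by
    have := isDiff_D (δ := dtb k 1) 1
    rwa [Nat.cast_one] at this
  have hf : ∀ j, IsDiff (ghostFactors Φ Ψ j) ∧ IsDiff (ghostFactors Φ Ψ (j + 1)) := by
    intro j
    induction j with
    | zero => exact ⟨isDiff_C 1, hD.sub (isDiff_C _)⟩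
    | succ j ih => exact ⟨ih.2, (hD.sub (isDiff_C _)).mul ih.2⟩
  exact (IsDiff.sum fun j _ => (isDiff_C _).mul (hf j).1).sub (isDiff_C _)

theorem ordLE_ghostDressing (h : IsGhostSystem L τ Φ Ψ S) :
    OrdLE (C (dtb k 1) (Φ 1)⁻¹ * ghostSeries Φ - 1) (-1) := by
  intro n hn
  rw [coeff_sub, coeff_C_mul, coeff_ghostSeries, coeff_one]
  rcases lt_or_ge 0 n with h0 | h0
  · rw [if_pos h0, if_neg h0.ne', mul_zero, sub_zero]
  · obtain rfl : n = 0 := by omega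
    rw [if_neg (by omega), if_pos rfl, show (1 - 0 : ℤ).toNat = 1 from rfl, mul_comm,
      MvPowerSeries.mul_inv_of_isUnit h.isUnit_Φ, sub_self]

/-- The ghost Lax operator, obtained by dressing. -/
theorem exists_ghostLax (h : IsGhostSystem L τ Φ Ψ S) : ∃ Lb : PDO (dtb k 1),
    IsGhostLax Φ Ψ Lb ∧ Lb * (C (dtb k 1) (Φ 1)⁻¹ * ghostSeries Φ) =
      C (dtb k 1) (Φ 1)⁻¹ * ghostSeries Φ * D (dtb k 1) 1 := by
  have hW1 := h.ordLE_ghostDressing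
  have hflow := h.flow_ghostDressing
  set W := C (dtb k 1) (Φ 1)⁻¹ * ghostSeries Φ
  obtain ⟨U, hWU, hUW, hU1⟩ := exists_inverse hW1
  have hL : W * D (dtb k 1) 1 * U * W = W * D (dtb k 1) 1 := by rw [mul_assoc, hUW, mul_one]
  have hplus : ∀ s, 1 ≤ s → ((W * D (dtb k 1) 1 * U).pow s).plus = ghostMbar Φ Ψ s := by
    intro s hs
    obtain ⟨s, rfl⟩ := Nat.exists_eq_succ_of_ne_zero (by omega : s ≠ 0)
    rw [pow_eq]
    exact plus_pow_of_flow hWU hW1 hU1 hL (isDiff_ghostMbar _) (hflow s)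
  -- `W D̄ W⁻¹ - D̄ = -(∂̄W) W⁻¹`, and `∂̄W` has order at most `-1`, so no `D̄^0` term appears.
  have hlow : OrdLE (W * D (dtb k 1) 1 * U - D (dtb k 1) 1) (-1) := by
    have e : W * D (dtb k 1) 1 * U - D (dtb k 1) 1 =
        ((W - 1) * D (dtb k 1) 1 - D (dtb k 1) 1 * (W - 1)) * U := by
      have : (D (dtb k 1) 1 * W) * U = D (dtb k 1) 1 := by rw [mul_assoc, hWU, mul_one]
      rw [sub_mul, sub_mul, mul_sub, sub_mul, sub_mul, this]
      simp
    have e2 : (W - 1) * D (dtb k 1) 1 - D (dtb k 1) 1 * (W - 1) =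
        -PDO.deriv (dtb k 1) (W - 1) := by
      rw [D_one_mul_eq]
      abel
    rw [e, e2]
    exact ((hW1.deriv _).neg.mul (ordLE_zero_of_sub_one hU1)).mono (by omega)
  have hcoeff : ∀ n, -1 < n → (W * D (dtb k 1) 1 * U).coeff n = if n = 1 then 1 else 0 := by
    intro n hn
    exact sub_eq_zero.1 (hlow n hn)
  refine ⟨W * D (dtb k 1) 1 * U, ⟨⟨fun n hn => ?_, ?_, ?_, fun s hs => ?_⟩, hplus⟩, hL⟩
  · rw [hcoeff n (by omega), if_neg (by omega)]
  · rw [hcoeff 1 (by omega), if_pos rfl]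
  · rw [hcoeff 0 (by omega), if_neg (by omega)]
  · rw [hplus s hs]
    obtain ⟨s, rfl⟩ := Nat.exists_eq_succ_of_ne_zero (by omega : s ≠ 0)
    exact lax_of_flow (dtb_comm _ _) hWU hUW hL (hflow s)

theorem ghostLax_unique [CharZero k] {Lb Lb' : PDO (dtb k 1)} (h : IsGhostLax Φ Ψ Lb)
    (h' : IsGhostLax Φ Ψ Lb') : Lb = Lb' :=
  eq_of_plus_pow_eq h.1.coeff_gt_one h'.1.coeff_gt_one h.1.coeff_one h'.1.coeff_one
    fun s hs => by rw [← pow_eq, ← pow_eq, h.2 s hs, h'.2 s hs]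

end IsGhostSystem

/-- Exchanging the outer two indices of a sum over `a + b + c = n`. -/
theorem sum_antidiagonal_triple_comm {M : Type*} [AddCommMonoid M] (n : ℕ)
    (f : ℕ → ℕ → ℕ → M) :
    ∑ p ∈ antidiagonal n, ∑ q ∈ antidiagonal p.1, f q.1 q.2 p.2 =
      ∑ p ∈ antidiagonal n, ∑ q ∈ antidiagonal p.1, f p.2 q.2 q.1 := by
  rw [Finset.sum_sigma', Finset.sum_sigma']
  refine Finset.sum_nbij' (fun x => ⟨(x.1.2 + x.2.2, x.2.1), (x.1.2, x.2.2)⟩)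
    (fun x => ⟨(x.1.2 + x.2.2, x.2.1), (x.1.2, x.2.2)⟩) ?_ ?_ ?_ ?_ ?_
  · rintro ⟨⟨p, p'⟩, ⟨q, q'⟩⟩ hx
    simp only [Finset.mem_sigma, mem_antidiagonal] at hx ⊢
    exact ⟨by omega, trivial⟩
  · rintro ⟨⟨p, p'⟩, ⟨q, q'⟩⟩ hx
    simp only [Finset.mem_sigma, mem_antidiagonal] at hx ⊢
    exact ⟨by omega, trivial⟩
  · rintro ⟨⟨p, p'⟩, ⟨q, q'⟩⟩ hx
    simp only [Finset.mem_sigma, mem_antidiagonal] at hx ⊢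
    simp only [hx.2]
  · rintro ⟨⟨p, p'⟩, ⟨q, q'⟩⟩ hx
    simp only [Finset.mem_sigma, mem_antidiagonal] at hx ⊢
    simp only [hx.2]
  · rintro ⟨⟨p, p'⟩, ⟨q, q'⟩⟩ hx
    rfl

/-! ### The tau-function of the ghost hierarchy. -/

namespace IsGhostSystem

open PDO

variable {k : Type*} [Field k] [CharZero k] {L : PDO (dt k 1)} {τ : TimeFun k}
  {Φ Ψ : ℕ → TimeFun k} {S : ℕ → ℕ → TimeFun k}

/-- `p_n(-[∂̄])(Φ_1 τ) = Φ_{n+1} τ` for the normalized tau-function. -/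
theorem schurOp_ghostTau (h : IsGhostSystem L τ Φ Ψ S) {τ₀ : TimeFun k} (hu : IsUnit τ₀)
    (hτ₀ : ∀ s, dlog (dtb k (s + 1)) τ₀ = -∑ p ∈ antidiagonal s, S (p.1 + 1) (p.2 + 1)) (n : ℕ) :
    schurOp (dtb k) n (Φ 1 * τ₀) = Φ (n + 1) * τ₀ := by
  induction n using Nat.strong_induction_on with
  | _ n ih =>
    rcases n with _ | n
    · rw [schurOp_zero]
    · apply nsmul_succ_left_injective (n := n)
      rw [schurOp_succ dtb_comm]
      have h1 : ∀ p ∈ antidiagonal n, dtb k (p.1 + 1) (schurOp (dtb k) p.2 (Φ 1 * τ₀)) =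
          τ₀ * (∑ q ∈ antidiagonal p.1, Φ (q.1 + 1) * S (p.2 + 1) (q.2 + 1) -
            ∑ q ∈ antidiagonal p.1, Φ (p.2 + 1) * S (q.1 + 1) (q.2 + 1)) -
          Φ (n + 2) * τ₀ := by
        intro p hp
        have hp' := mem_antidiagonal.1 hp
        rw [ih p.2 (by omega), Derivation.leibniz, ← dlog_mul_self hu, hτ₀, h.dtb_Φ _ (by omega),
          ← Finset.mul_sum, show p.2 + 1 + (p.1 + 1) = n + 2 by omega, smul_eq_mul, smul_eq_mul]
        ring
      -- The terms with potentials, from the flow of `Φ_{b+1}` and from `∂_{t̄} ln τ₀`, run over the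
      -- same triples with the outer indices exchanged. They cancel, leaving `n + 1` copies of
      -- `Φ_{n+2} τ₀`.
      have h2 := sum_antidiagonal_triple_comm n
        (fun a b c => Φ (a + 1) * S (c + 1) (b + 1))
      rw [Finset.sum_congr rfl h1, Finset.sum_sub_distrib, ← Finset.mul_sum,
        Finset.sum_sub_distrib, h2, sub_self, Finset.sum_const, Finset.Nat.card_antidiagonal]
      simp

theorem dressing_ghostTau (h : IsGhostSystem L τ Φ Ψ S) {τ₀ : TimeFun k} (hu : IsUnit τ₀)
    (hτ₀ : ∀ s, dlog (dtb k (s + 1)) τ₀ = -∑ p ∈ antidiagonal s, S (p.1 + 1) (p.2 + 1)) :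
    dressing (dtb k) (Φ 1 * τ₀) = C (dtb k 1) (Φ 1)⁻¹ * ghostSeries Φ := by
  ext1
  funext n
  rw [coeff_C_mul, coeff_ghostSeries]
  simp only [dressing]
  split_ifs with hn
  · rw [mul_zero]
  · rw [h.schurOp_ghostTau hu hτ₀, MvPowerSeries.mul_inv_rev,
      show (1 - n).toNat = (-n).toNat + 1 by omega, ← mul_assoc, mul_assoc (Φ _),
      MvPowerSeries.mul_inv_of_isUnit hu, mul_one, mul_comm]

theorem isTauFunction_ghostTau (h : IsGhostSystem L τ Φ Ψ S) {τ₀ : TimeFun k} (hu : IsUnit τ₀)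
    (hτ₀ : ∀ s, dlog (dtb k (s + 1)) τ₀ = -∑ p ∈ antidiagonal s, S (p.1 + 1) (p.2 + 1))
    {Lb : PDO (dtb k 1)} (hLb : IsGhostLax Φ Ψ Lb) : IsTauFunction (dtb k) Lb (Φ 1 * τ₀) := by
  obtain ⟨Lb', hLb', hdress⟩ := h.exists_ghostLax
  -- Uniqueness identifies the given operator with the one constructed by dressing.
  obtain rfl := ghostLax_unique hLb hLb'
  have hunit := h.isUnit_Φ.mul hu
  have hW := h.dressing_ghostTau hu hτ₀
  have hW1 := h.ordLE_ghostDressing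
  obtain ⟨U, hWU, hUW, -⟩ := exists_inverse hW1
  have hflow := h.flow_ghostDressing
  rw [← hW] at hdress hflow hW1 hWU hUW
  have hsato : ∀ l, 1 ≤ l → PDO.deriv (dtb k l) (dressing (dtb k) (Φ 1 * τ₀)) =
      -((Lb.pow l).minus * dressing (dtb k) (Φ 1 * τ₀)) := by
    intro l hl
    obtain ⟨l, rfl⟩ := Nat.exists_eq_succ_of_ne_zero (by omega : l ≠ 0)
    have h1 := hflow l
    rw [← eq_sub_iff_add_eq, ← hLb.2 (l + 1) (by omega)] at h1
    have h2 : dressing (dtb k) (Φ 1 * τ₀) * D (dtb k 1) (l + 1 : ℕ) =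
        Lb ^ (l + 1) * dressing (dtb k) (Φ 1 * τ₀) := by
      rw [pow_dressed hWU hdress, mul_assoc, hUW, mul_one]
    rw [Nat.succ_eq_add_one, h1, h2, ← pow_eq, ← sub_mul, ← neg_mul]
    congr 1
    exact sub_eq_of_eq_add (eq_neg_add_of_add_eq (by rw [add_comm, plus_add_minus]))
  refine ⟨hunit, hdress, hsato, fun l hl => ?_⟩
  have h1 := congrArg (fun P => P.coeff (-1 : ℤ)) (hsato l hl)
  -- Since `p_1(-[∂̄]) = -∂̄`, comparing coefficients of `D̄⁻¹` in the Sato equation yields the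
  -- residue condition.
  have h2 : (dressing (dtb k) (Φ 1 * τ₀)).coeff (-1) = -dlog (dtb k 1) (Φ 1 * τ₀) := by
    have e1 := coeff_dressing_neg (dtb k) (Φ 1 * τ₀) 1
    have e2 := schurOp_succ (d := dtb k) dtb_comm 0 (Φ 1 * τ₀)
    rw [zero_add, one_smul, Finset.Nat.antidiagonal_zero, Finset.sum_singleton, schurOp_zero] at e2
    rw [Nat.cast_one] at e1
    rw [e1, e2, dlog, neg_mul]
  have h3 := coeff_mul_top (ordLE_minus (Lb.pow l)) (ordLE_zero_of_sub_one hW1)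
  rw [add_zero, coeff_dressing_zero hunit, mul_one] at h3
  simp only [coeff_deriv, coeff_neg] at h1
  rw [h2, h3, map_neg, neg_inj] at h1
  rw [dlog_comm (dtb_comm _ _) hunit, h1]
  simp [minus, res]

end IsGhostSystem

theorem mainTheorem5 {k : Type*} [Field k] [CharZero k] (L : PDO (dt k 1)) (τ : TimeFun k)
    (Φ Ψ : ℕ → TimeFun k) (S : ℕ → ℕ → TimeFun k) (h : IsGhostSystem L τ Φ Ψ S) :
    -- the ghost Lax operator exists and is unique
    (∃! Lb : PDO (dtb k 1), IsGhostLax Φ Ψ Lb) ∧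
    -- up to a factor depending only on `t̄`, the tau-function of `L` satisfies
    -- `∂/∂t̄_s ln τ = - ∑_{j=1}^s ∂⁻¹(Φ_{s-j+1} Ψ_j)`; take `τ₀` so normalized
    ∃ τ₀ : TimeFun k,
      (∃ c : TimeFun k, IsUnit c ∧ (∀ l, 1 ≤ l → dt k l c = 0) ∧ τ₀ = c * τ) ∧
      IsTauFunction (dt k) L τ₀ ∧
      (∀ s, 1 ≤ s → dlog (dtb k s) τ₀ = -∑ j ∈ Finset.Icc 1 s, S (s - j + 1) j) ∧
      (∀ Lb : PDO (dtb k 1), IsGhostLax Φ Ψ Lb → IsTauFunction (dtb k) Lb (Φ 1 * τ₀)) ∧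
      (∀ s : ℕ, schurOp (dtb k) s (Φ 1 * τ₀) * (Φ 1 * τ₀)⁻¹ = Φ (s + 1) * (Φ 1)⁻¹) := by
  obtain ⟨c, hc, hc', hτ₀⟩ := h.exists_normalized_tau
  have hu : IsUnit (c * τ) := hc.mul h.tau.isUnit
  refine ⟨?_, c * τ, ⟨c, hc, hc', rfl⟩, h.tau.const_mul dt_comm hc hc', fun s hs => ?_,
    fun Lb hLb => h.isTauFunction_ghostTau hu hτ₀ hLb, fun s => ?_⟩
  · obtain ⟨Lb, hLb, -⟩ := h.exists_ghostLax
    exact ⟨Lb, hLb, fun Lb' hLb' => IsGhostSystem.ghostLax_unique hLb' hLb⟩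
  · obtain ⟨s, rfl⟩ := Nat.exists_eq_succ_of_ne_zero (by omega : s ≠ 0)
    rw [Nat.succ_eq_add_one, hτ₀, sum_Icc_eq_sum_antidiagonal s (fun a b => S a b)]
  · rw [h.schurOp_ghostTau hu hτ₀, MvPowerSeries.mul_inv_rev, ← mul_assoc, mul_assoc (Φ _),
      MvPowerSeries.mul_inv_of_isUnit hu, mul_one]
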